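/- Let $k$ be a field of characteristic $0$ and let $$A = k\langle x,y,z\rangle/(x^2+yx,\; xz,\; zy)$$ be the quotient of the free associative unital $k$-algebra on $x,y,z$ by the two-sided ideal generated by $x^2+yx$, $xz$ and $zy$. Let $A^e = A\otimes_k A^{\mathrm{op}}$, and regard $A$ as a left $A^e$-module via $(b\otimes c)\cdot a = bac$ and as a right $A^e$-module via $a\cdot(b\otimes c) = cab$. Then the Hochschild homology $HH_n(A) = \mathrm{Tor}_n^{A^e}(A,A)$ is zero for every integer $n\ge 2$. -/

import Mathlib

open CategoryTheory TensorProduct MulOpposite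
open scoped ModuleCat

universe u

noncomputable section

namespace NCTor

/-! ## The tensor product over a noncommutative algebra and its derived functors

`k` is a field and `R` is an arbitrary (associative, unital) `k`-algebra. A right `R`-module is a
module over `Rᵐᵒᵖ`. Modules over a `k`-algebra are regarded as `k`-vector spaces through the
structure map of the algebra. -/

section Tensor

variable (k : Type u) [Field k] {R : Type u} [Ring R] [Algebra k R]

/-- The subspace of `M ⊗[k] N` spanned by the elements `m r ⊗ n - m ⊗ r n`. -/
def balancing (M : ModuleCat.{u} Rᵐᵒᵖ) (N : ModuleCat.{u} R) : Submodule k (M ⊗[k] N) :=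
  Submodule.span k
    {t | ∃ (m : M) (r : R) (n : N), t = (op r • m) ⊗ₜ[k] n - m ⊗ₜ[k] (r • n)}

/-- The tensor product `M ⊗_R N` of a right `R`-module and a left `R`-module,
as a `k`-vector space. -/
abbrev BalancedTensor (M : ModuleCat.{u} Rᵐᵒᵖ) (N : ModuleCat.{u} R) : Type u :=
  (M ⊗[k] N) ⧸ balancing k M N

/-- The `k`-linear map underlying an `R`-linear map. -/
def underlying {N N' : ModuleCat.{u} R} (f : N ⟶ N') : N →ₗ[k] N' :=
  f.hom.restrictScalars k

@[simp]
theorem underlying_apply {N N' : ModuleCat.{u} R} (f : N ⟶ N') (n : N) :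
    underlying k f n = f.hom n := rfl

theorem balancing_le_comap (M : ModuleCat.{u} Rᵐᵒᵖ) {N N' : ModuleCat.{u} R} (f : N ⟶ N') :
    balancing k M N ≤ (balancing k M N').comap ((underlying k f).lTensor M) := by
  refine Submodule.span_le.2 ?_
  rintro _ ⟨m, r, n, rfl⟩
  refine Submodule.subset_span ⟨m, r, f.hom n, ?_⟩
  simp

/-- The map `id ⊗ f : M ⊗_R N → M ⊗_R N'` induced by an `R`-linear map `f : N → N'`. -/
def BalancedTensor.map (M : ModuleCat.{u} Rᵐᵒᵖ) {N N' : ModuleCat.{u} R} (f : N ⟶ N') :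
    BalancedTensor k M N →ₗ[k] BalancedTensor k M N' :=
  Submodule.mapQ _ _ ((underlying k f).lTensor M) (balancing_le_comap k M f)

@[simp]
theorem BalancedTensor.map_mk_tmul (M : ModuleCat.{u} Rᵐᵒᵖ) {N N' : ModuleCat.{u} R}
    (f : N ⟶ N') (m : M) (n : N) :
    BalancedTensor.map k M f (Submodule.Quotient.mk (m ⊗ₜ[k] n)) =
      Submodule.Quotient.mk (m ⊗ₜ[k] f.hom n) := rfl

theorem BalancedTensor.hom_ext {M : ModuleCat.{u} Rᵐᵒᵖ} {N : ModuleCat.{u} R}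
    {P : Type*} [AddCommGroup P] [Module k P] {f g : BalancedTensor k M N →ₗ[k] P}
    (h : ∀ (m : M) (n : N), f (Submodule.Quotient.mk (m ⊗ₜ[k] n)) =
      g (Submodule.Quotient.mk (m ⊗ₜ[k] n))) : f = g := by
  refine Submodule.linearMap_qext _ (TensorProduct.ext' fun m n => ?_)
  exact h m n

end Tensor

section Tor

variable (k : Type u) [Field k] {R : Type u} [Ring R] [Algebra k R]

/-- The functor `M ⊗_R -` from left `R`-modules to `k`-vector spaces. -/
def tensorFunctor (M : ModuleCat.{u} Rᵐᵒᵖ) : ModuleCat.{u} R ⥤ ModuleCat.{u} k where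
  obj N := ModuleCat.of k (BalancedTensor k M N)
  map f := ModuleCat.ofHom (BalancedTensor.map k M f)
  map_id N := by
    apply ModuleCat.hom_ext
    apply BalancedTensor.hom_ext
    intro m n
    simp
  map_comp f g := by
    apply ModuleCat.hom_ext
    apply BalancedTensor.hom_ext
    intro m n
    simp

instance tensorFunctor_additive (M : ModuleCat.{u} Rᵐᵒᵖ) : (tensorFunctor k M).Additive where
  map_add {N N'} f g := by
    apply ModuleCat.hom_ext
    apply BalancedTensor.hom_ext
    intro m n
    change Submodule.Quotient.mk (m ⊗ₜ[k] (f.hom n + g.hom n)) = _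
    rw [TensorProduct.tmul_add]
    rfl

/-- `Tor_n^R(M, N)` for a right `R`-module `M` and a left `R`-module `N`: the `n`-th left derived
functor of `M ⊗_R -`, applied to `N`. -/
def Tor (n : ℕ) (M : ModuleCat.{u} Rᵐᵒᵖ) (N : ModuleCat.{u} R) : ModuleCat.{u} k :=
  ((tensorFunctor k M).leftDerived n).obj N

end Tor

end NCTor

namespace Hochschild

/-! ## Hochschild homology of an associative algebra -/

variable (k : Type u) [Field k] (A : Type u) [Ring A] [Algebra k A]

/-- The enveloping algebra `Aᵉ = A ⊗ Aᵒᵖ`. -/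
abbrev Env : Type u := A ⊗[k] Aᵐᵒᵖ

/-- The canonical isomorphism `(Aᵉ)ᵒᵖ ≃ Aᵉ` that exchanges the two tensor factors. -/
def envOpEquiv : (Env k A)ᵐᵒᵖ ≃ₐ[k] Env k A :=
  (Algebra.TensorProduct.opAlgEquiv k k A Aᵐᵒᵖ).symm.trans
    ((Algebra.TensorProduct.comm k Aᵐᵒᵖ Aᵐᵒᵖᵐᵒᵖ).trans
      (Algebra.TensorProduct.congr (AlgEquiv.opOp k A).symm AlgEquiv.refl))

@[simp]
theorem envOpEquiv_op_tmul (b c : A) :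
    envOpEquiv k A (op (b ⊗ₜ[k] op c)) = c ⊗ₜ[k] op b := rfl

/-- `A` as a left `Aᵉ`-module: `(b ⊗ c) · a = b a c`. -/
abbrev leftModule : Module (Env k A) A :=
  Module.compHom A (AlgHom.mulLeftRight k A).toRingHom

/-- `A` as a right `Aᵉ`-module: `a · (b ⊗ c) = c a b`. -/
abbrev rightModule : Module (Env k A)ᵐᵒᵖ A :=
  Module.compHom A ((AlgHom.mulLeftRight k A).comp (envOpEquiv k A).toAlgHom).toRingHom

/-- The left `Aᵉ`-module `A`. -/
def leftA : ModuleCat.{u} (Env k A) :=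
  letI := leftModule k A
  ModuleCat.of (Env k A) A

/-- The right `Aᵉ`-module `A`. -/
def rightA : ModuleCat.{u} (Env k A)ᵐᵒᵖ :=
  letI := rightModule k A
  ModuleCat.of (Env k A)ᵐᵒᵖ A

/-- The identity of `A`, as a map onto the left `Aᵉ`-module `A`. -/
def toLeftA : A ≃+ leftA k A := AddEquiv.refl A

/-- The identity of `A`, as a map onto the right `Aᵉ`-module `A`. -/
def toRightA : A ≃+ rightA k A := AddEquiv.refl A

theorem leftA_smul (b c a : A) :
    (b ⊗ₜ[k] op c : Env k A) • toLeftA k A a = toLeftA k A (b * a * c) :=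
  AlgHom.mulLeftRight_apply k A b (op c) a

theorem rightA_smul (b c a : A) :
    op (b ⊗ₜ[k] op c : Env k A) • toRightA k A a = toRightA k A (c * a * b) :=
  AlgHom.mulLeftRight_apply k A c (op b) a

/-- The `k`-structure that `A` receives as a left `Aᵉ`-module is the original one. -/
theorem leftA_smul_base (r : k) (a : A) : r • toLeftA k A a = toLeftA k A (r • a) := by
  rw [← algebraMap_smul (Env k A) r (toLeftA k A a)]
  refine (leftA_smul k A (algebraMap k A r) 1 a).trans ?_
  rw [mul_one, Algebra.smul_def]

/-- The `k`-structure that `A` receives as a right `Aᵉ`-module is the original one. -/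
theorem rightA_smul_base (r : k) (a : A) : r • toRightA k A a = toRightA k A (r • a) := by
  rw [← algebraMap_smul (Env k A)ᵐᵒᵖ r (toRightA k A a)]
  refine (rightA_smul k A (algebraMap k A r) 1 a).trans ?_
  rw [one_mul, Algebra.smul_def, Algebra.commutes]

/-- Hochschild homology `HH_n(A) = Tor_n^{Aᵉ}(A, A)`. -/
def HH (n : ℕ) : ModuleCat.{u} k :=
  NCTor.Tor k n (rightA k A) (leftA k A)

end Hochschild

namespace KoszulExample

/-! ## The algebra `k⟨x, y, z⟩ / (x² + yx, xz, zy)` -/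

/-- The three generators. -/
inductive Gen : Type
  | x
  | y
  | z

variable (k : Type u) [Field k]

/-- The noncommutative polynomial attached to a generator. -/
abbrev gen (g : Gen) : FreeAlgebra k Gen := FreeAlgebra.ι k g

/-- The defining relations `x² + yx = 0`, `xz = 0` and `zy = 0`. -/
inductive Rel : FreeAlgebra k Gen → FreeAlgebra k Gen → Prop
  | xx_yx : Rel (gen k Gen.x * gen k Gen.x + gen k Gen.y * gen k Gen.x) 0
  | xz : Rel (gen k Gen.x * gen k Gen.z) 0
  | zy : Rel (gen k Gen.z * gen k Gen.y) 0

/-- The algebra `A = k⟨x, y, z⟩ / (x² + yx, xz, zy)`. -/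
abbrev Alg : Type u := RingQuot (Rel k)

end KoszulExample

end

/-! Put `u = x + y`. The relations become `ux`, `xz`, `zy`, a chain u, x, z, y in which consecutive
relations overlap in `uxz`, `xzy` and `uxzy` and in nothing longer. Accordingly `A` has a Koszul
bimodule resolution by free `Aᵉ`-modules of ranks 1, 3, 3, 2, 1 (`koszulResolution`).

Everything rests on annihilators. For right multiplication, `au = 0` forces `a = 0`, while `ax = 0`,
`az = 0`, `ay = 0` force `a` into `Au`, `Ax`, `Az`. For left multiplication, `ya = 0` forces `a =
0`, while `xa = 0`, `za = 0` force `a` into `zA`, `yA`. These facts are read off from two bases of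
normal words, `rightBasis` and `leftBasis`, whose independence comes from the regular
representations.

In degrees 2 and above, exactness of the resolution is a short chase with these facts (`exact_two`,
`exact_three`, `eq_zero_of_mul_onL_au`). In degree 1 (`exact_one`) the left factor of `Aᵉ` is
filtered by weight, so that to leading order only the part of the differential acting on the left
factor matters. Degree 0 is the Leibniz rule.

Tensoring with `A` lets both kinds of multiplication act on the same copy of `A`. The resulting
complex is exact in degrees 2, 3, 4 by the same annihilator facts, now from both sides
(`hochschild_two`, `hochschild_three`, `hochschild_four`), and it vanishes above degree 4. -/

noncomputable section

namespace KoszulExample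

/-! ### The presentation by `x, u, z` and its universal property -/

variable (k : Type u) [Field k]

/-- The image of a generator in the algebra. -/
def letter (g : Gen) : Alg k := RingQuot.mkAlgHom k (Rel k) (gen k g)

/-- The generator `x`. -/
abbrev ax : Alg k := letter k Gen.x
/-- The generator `y`. -/
abbrev ay : Alg k := letter k Gen.y
/-- The generator `z`. -/
abbrev az : Alg k := letter k Gen.z
/-- The element `u = x + y`; with the letters `x, u, z` the relations become monomial ones,
`ux = 0`, `xz = 0` and `zu = zx`. -/
def au : Alg k := ax k + ay k

theorem ay_eq : ay k = au k - ax k := by simp [au]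

@[simp] theorem au_mul_ax : au k * ax k = 0 := by
  have h := RingQuot.mkAlgHom_rel k (Rel.xx_yx (k := k))
  simpa [au, add_mul, letter] using h

@[simp] theorem ax_mul_az : ax k * az k = 0 := by
  simpa [letter] using RingQuot.mkAlgHom_rel k (Rel.xz (k := k))

@[simp] theorem az_mul_ay : az k * ay k = 0 := by
  simpa [letter] using RingQuot.mkAlgHom_rel k (Rel.zy (k := k))

theorem az_mul_au : az k * au k = az k * ax k := by
  simp [au, mul_add]

@[simp] theorem mul_au_mul_ax (a : Alg k) : a * au k * ax k = 0 := by simp [mul_assoc]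
@[simp] theorem mul_ax_mul_az (a : Alg k) : a * ax k * az k = 0 := by simp [mul_assoc]
theorem mul_az_mul_au (a : Alg k) : a * az k * au k = a * az k * ax k := by
  simp only [mul_assoc, az_mul_au]

@[simp] theorem au_mul_ax_mul (a : Alg k) : au k * (ax k * a) = 0 := by simp [← mul_assoc]
@[simp] theorem ax_mul_az_mul (a : Alg k) : ax k * (az k * a) = 0 := by simp [← mul_assoc]
theorem az_mul_au_mul (a : Alg k) : az k * (au k * a) = az k * (ax k * a) := by
  simp only [← mul_assoc, az_mul_au]

-- The overlap `zux` of `zu = zx` with `ux = 0` forces `zxx = 0`. The normal words avoid `ux`, `xz`,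
-- `zu` and `zxx`.
@[simp] theorem mul_az_mul_ax_mul_ax (a : Alg k) : a * az k * ax k * ax k = 0 := by
  rw [← mul_az_mul_au, mul_au_mul_ax]

variable {k}

theorem Alg.induction {p : Alg k → Prop} (base : ∀ r, p (algebraMap k _ r))
    (hg : ∀ g, p (letter k g)) (add : ∀ a b, p a → p b → p (a + b))
    (mul : ∀ a b, p a → p b → p (a * b)) (a : Alg k) : p a := by
  obtain ⟨b, rfl⟩ := RingQuot.mkAlgHom_surjective k (Rel k) a
  induction b using FreeAlgebra.induction with
  | grade0 r => simpa using base r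
  | grade1 g => exact hg g
  | mul a b ha hb => rw [map_mul]; exact mul _ _ ha hb
  | add a b ha hb => rw [map_add]; exact add _ _ ha hb

/-- An algebra homomorphism out of the algebra, from the values on `x`, `u`, `z`. -/
def liftXUZ {B : Type*} [Ring B] [Algebra k B] (X U Z : B) (h1 : U * X = 0) (h2 : X * Z = 0)
    (h3 : Z * U = Z * X) : Alg k →ₐ[k] B :=
  RingQuot.liftAlgHom k ⟨FreeAlgebra.lift k (fun g => match g with
    | Gen.x => X | Gen.y => U - X | Gen.z => Z), by
      rintro _ _ (_ | _ | _)
      · simp [← add_mul, h1]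
      · simp [h2]
      · simp [mul_sub, h3]⟩

section lift
variable {B : Type*} [Ring B] [Algebra k B] {X U Z : B} (h1 : U * X = 0) (h2 : X * Z = 0)
    (h3 : Z * U = Z * X)

@[simp] theorem liftXUZ_ax : liftXUZ (k := k) X U Z h1 h2 h3 (ax k) = X := by
  simp [liftXUZ, letter]
@[simp] theorem liftXUZ_ay : liftXUZ (k := k) X U Z h1 h2 h3 (ay k) = U - X := by
  simp [liftXUZ, letter]
@[simp] theorem liftXUZ_az : liftXUZ (k := k) X U Z h1 h2 h3 (az k) = Z := by
  simp [liftXUZ, letter]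
@[simp] theorem liftXUZ_au : liftXUZ (k := k) X U Z h1 h2 h3 (au k) = U := by
  simp [au]
end lift

/-- The linear endomorphism attached to a partially defined self-map of a basis. -/
def partialOp (k : Type u) [Field k] {W : Type} (f : W → Option W) : Module.End k (W →₀ k) :=
  Finsupp.linearCombination k fun w => (f w).elim 0 fun w' => Finsupp.single w' 1

@[simp] theorem partialOp_single {W : Type} (f : W → Option W) (w : W) (r : k) :
    partialOp k f (Finsupp.single w r) = (f w).elim 0 fun w' => Finsupp.single w' r := by
  simp only [partialOp, Finsupp.linearCombination_single]
  cases f w <;> simp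

/-! ### Normal words, built by multiplication on the right -/

/-- Normal words that may be followed by `z`. The word `u b` stands for `b u`, or for `b x u` when
`b` ends with `z`; the word `xu n` stands for `xⁿ⁺¹ u`. -/
inductive RBase : Type
  | nil
  | xu (n : ℕ)
  | u (b : RBase)
  | z (b : RBase)

/-- Normal words. -/
inductive RWord : Type
  | base (b : RBase)
  | xpow (n : ℕ)
  | zx (b : RBase)

namespace RWord

/-- Multiplication by `x` on the right. -/
def mulX : RWord → Option RWord
  | base .nil => some (xpow 0)
  | base (.z b) => some (zx b)
  | base (.u _) => none
  | base (.xu _) => none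
  | xpow n => some (xpow (n + 1))
  | zx _ => none

/-- Multiplication by `u` on the right. -/
def mulU : RWord → Option RWord
  | base (.z b) => some (zx b)
  | base .nil => some (base (.u .nil))
  | base (.u b) => some (base (.u (.u b)))
  | base (.xu n) => some (base (.u (.xu n)))
  | xpow n => some (base (.xu n))
  | zx b => some (base (.u (.z b)))

/-- Multiplication by `z` on the right. -/
def mulZ : RWord → Option RWord
  | base b => some (base (.z b))
  | xpow _ => none
  | zx _ => none

end RWord

open RWord

/-- The value of a word in the algebra. -/
def RBase.eval (k : Type u) [Field k] : RBase → Alg k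
  | .nil => 1
  | .xu n => ax k ^ (n + 1) * au k
  | .u (.z b) => RBase.eval k b * az k * ax k * au k
  | .u .nil => au k
  | .u (.u b) => RBase.eval k (.u b) * au k
  | .u (.xu n) => ax k ^ (n + 1) * au k * au k
  | .z b => RBase.eval k b * az k

/-- The value of a word in the algebra. -/
def RWord.eval (k : Type u) [Field k] : RWord → Alg k
  | base b => b.eval k
  | xpow n => ax k ^ (n + 1)
  | zx b => b.eval k * az k * ax k

/-- The right regular representation in terms of normal words. -/
def rightRep (k : Type u) [Field k] : Alg k →ₐ[k] (Module.End k (RWord →₀ k))ᵐᵒᵖ :=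
  liftXUZ (op (partialOp k mulX)) (op (partialOp k mulU)) (op (partialOp k mulZ))
    (by
      -- In the opposite ring the product is the composite that appends `u` first and `x`
      -- afterwards, as the relation `ux = 0` demands.
      rw [← op_mul]; apply congrArg op; ext w : 1
      rcases w with (_ | _ | _ | _) | _ | _ <;> ext <;> simp [mulX, mulU])
    (by
      rw [← op_mul]; apply congrArg op; ext w : 1
      rcases w with (_ | _ | _ | _) | _ | _ <;> ext <;> simp [mulX, mulZ])
    (by
      rw [← op_mul, ← op_mul]; apply congrArg op; ext w : 1
      rcases w with (_ | _ | _ | _) | _ | _ <;> ext <;> simp [mulX, mulU, mulZ])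

theorem eval_mulX (w : RWord) : (w.mulX).elim 0 (RWord.eval k) = w.eval k * ax k := by
  rcases w with (_ | _ | b | _) | _ | _ <;> try simp [mulX, RWord.eval, RBase.eval, pow_succ]
  cases b <;> simp [RBase.eval]

theorem eval_mulU (w : RWord) : (w.mulU).elim 0 (RWord.eval k) = w.eval k * au k := by
  rcases w with (_ | _ | _ | _) | _ | _ <;>
    simp [mulU, RWord.eval, RBase.eval, mul_az_mul_au]

theorem eval_mulZ (w : RWord) : (w.mulZ).elim 0 (RWord.eval k) = w.eval k * az k := by
  rcases w with (_ | _ | _ | _) | _ | _ <;> simp [mulZ, RWord.eval, RBase.eval, pow_succ]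

/-- The linear map from formal combinations of words to the algebra. -/
def rightEval (k : Type u) [Field k] : (RWord →₀ k) →ₗ[k] Alg k :=
  Finsupp.linearCombination k (RWord.eval k)

theorem rightEval_partialOp {f : RWord → Option RWord} {g : Alg k}
    (h : ∀ w, (f w).elim 0 (RWord.eval k) = w.eval k * g) (v : RWord →₀ k) :
    rightEval k (partialOp k f v) = rightEval k v * g := by
  suffices rightEval k ∘ₗ partialOp k f = LinearMap.mulRight k g ∘ₗ rightEval k from
    LinearMap.congr_fun this v
  ext w
  have := h w
  cases hf : f w <;> simp_all [rightEval]

/-- Evaluation intertwines the representation with right multiplication. Taking `v` to be the empty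
word shows that `rightEval` inverts `rightCoord` on one side, so the normal words span. -/
theorem rightEval_rightRep (a : Alg k) (v : RWord →₀ k) :
    rightEval k ((rightRep k a).unop v) = rightEval k v * a := by
  induction a using Alg.induction generalizing v with
  | base r => simp [Algebra.algebraMap_eq_smul_one]
  | add a b ha hb => simp [ha, hb, mul_add]
  | mul a b ha hb => simp [ha, hb, mul_assoc]
  | hg g =>
    cases g with
    | x => simp [rightRep, rightEval_partialOp eval_mulX]
    | y => simp [rightRep, rightEval_partialOp eval_mulX, rightEval_partialOp eval_mulU, mul_sub,
        ay_eq]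
    | z => simp [rightRep, rightEval_partialOp eval_mulZ]

/-- The coordinates of an element with respect to the normal words. -/
def rightCoord (k : Type u) [Field k] : Alg k →ₗ[k] (RWord →₀ k) :=
  (LinearMap.applyₗ (Finsupp.single (base .nil) (1 : k))) ∘ₗ
    (opLinearEquiv k).symm.toLinearMap ∘ₗ (rightRep k).toLinearMap

theorem rightCoord_apply (a : Alg k) :
    rightCoord k a = (rightRep k a).unop (Finsupp.single (base .nil) 1) := rfl

theorem rightCoord_mul_au (a : Alg k) :
    rightCoord k (a * au k) = partialOp k mulU (rightCoord k a) := by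
  simp [rightCoord_apply, rightRep]

theorem rightCoord_mul_ax (a : Alg k) :
    rightCoord k (a * ax k) = partialOp k mulX (rightCoord k a) := by
  simp [rightCoord_apply, rightRep]

theorem rightCoord_mul_az (a : Alg k) :
    rightCoord k (a * az k) = partialOp k mulZ (rightCoord k a) := by
  simp [rightCoord_apply, rightRep]

theorem rightCoord_one : rightCoord k 1 = Finsupp.single (base .nil) 1 := by
  simp [rightCoord_apply]

theorem rightCoord_pow (n : ℕ) :
    rightCoord k (ax k ^ (n + 1)) = Finsupp.single (xpow n) 1 := by
  induction n with
  | zero => rw [pow_one, ← one_mul (ax k), rightCoord_mul_ax, rightCoord_one]; simp [mulX]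
  | succ n ih => rw [pow_succ, rightCoord_mul_ax, ih]; simp [mulX]

theorem rightCoord_evalBase (b : RBase) :
    rightCoord k (b.eval k) = Finsupp.single (base b) 1 := by
  induction b using RBase.eval.induct with
  | case1 => simp [RBase.eval, rightCoord_one]
  | case2 n => simp [RBase.eval, rightCoord_mul_au, rightCoord_pow, mulU]
  | case3 b ih =>
    simp [RBase.eval, rightCoord_mul_au, rightCoord_mul_ax, rightCoord_mul_az, ih, mulU, mulX, mulZ]
  | case4 =>
    rw [RBase.eval, ← one_mul (au k), rightCoord_mul_au, rightCoord_one]; simp [mulU]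
  | case5 b ih => simp [RBase.eval, rightCoord_mul_au, ih, mulU]
  | case6 n => simp [RBase.eval, rightCoord_mul_au, rightCoord_pow, mulU]
  | case7 b ih => simp [RBase.eval, rightCoord_mul_az, ih, mulZ]

/-- This is the linear independence of the normal words: letting a word act on the empty word
rebuilds that word. -/
theorem rightCoord_eval (w : RWord) : rightCoord k (w.eval k) = Finsupp.single w 1 := by
  cases w <;> simp [RWord.eval, rightCoord_evalBase, rightCoord_pow, rightCoord_mul_ax,
    rightCoord_mul_az, mulX, mulZ]

/-- The basis of normal words. -/
def rightBasis (k : Type u) [Field k] : Module.Basis RWord k (Alg k) :=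
  .ofRepr <| LinearEquiv.ofLinearMap (rightCoord k) (rightEval k)
    (by ext w : 2; simp [rightEval, rightCoord_eval])
    (by
      apply LinearMap.ext; intro a
      simp [rightCoord_apply, rightEval_rightRep]
      simp [rightEval, RWord.eval, RBase.eval])

theorem rightBasis_apply (w : RWord) : rightBasis k w = w.eval k := by
  simp [rightBasis, rightEval]

theorem rightBasis_mul_ax (w : RWord) :
    rightBasis k w * ax k = (w.mulX).elim 0 (rightBasis k) := by
  rw [rightBasis_apply, ← eval_mulX]
  cases w.mulX <;> simp [rightBasis_apply]

theorem rightBasis_mul_au (w : RWord) :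
    rightBasis k w * au k = (w.mulU).elim 0 (rightBasis k) := by
  rw [rightBasis_apply, ← eval_mulU]
  cases w.mulU <;> simp [rightBasis_apply]

theorem rightBasis_mul_az (w : RWord) :
    rightBasis k w * az k = (w.mulZ).elim 0 (rightBasis k) := by
  rw [rightBasis_apply, ← eval_mulZ]
  cases w.mulZ <;> simp [rightBasis_apply]

/-! ### Deletion of the last letter -/

namespace RWord

/-- Deletion of a final `u`. -/
def delU : RWord → Option RWord
  | base (.u (.z b)) => some (zx b)
  | base (.u .nil) => some (base .nil)
  | base (.u (.u b)) => some (base (.u b))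
  | base (.u (.xu n)) => some (base (.xu n))
  | base (.xu n) => some (xpow n)
  | zx b => some (base (.z b))
  | _ => none

/-- Deletion of a final `x`. -/
def delX : RWord → Option RWord
  | xpow 0 => some (base .nil)
  | xpow (n + 1) => some (xpow n)
  | zx b => some (base (.z b))
  | _ => none

/-- Deletion of a final `x`, where a word `xⁿ u` is also regarded as ending with `x`. -/
def delX' : RWord → Option RWord
  | xpow 0 => some (base .nil)
  | xpow (n + 1) => some (xpow n)
  | zx b => some (base (.z b))
  | base (.u .nil) => some (base .nil)
  | base (.xu n) => some (xpow n)
  | _ => none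

/-- Deletion of a final `u`, except that words `b z x = b z u` are sent to zero. -/
def delY : RWord → Option RWord
  | zx _ => none
  | w => w.delU

/-- Deletion of a final `z`. -/
def delZ : RWord → Option RWord
  | base (.z b) => some (base b)
  | _ => none

end RWord

/-- The linear endomorphism of the algebra attached to a partially defined map of words. -/
def wordOp (k : Type u) [Field k] (f : RWord → Option RWord) : Alg k →ₗ[k] Alg k :=
  (rightBasis k).constr k fun w => (f w).elim 0 (rightBasis k)

@[simp] theorem wordOp_basis (f : RWord → Option RWord) (w : RWord) :
    wordOp k f (rightBasis k w) = (f w).elim 0 (rightBasis k) := by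
  simp [wordOp]

theorem Alg.linearMap_ext_right {V : Type*} [AddCommGroup V] [Module k V] {f g : Alg k →ₗ[k] V}
    (h : ∀ w, f (rightBasis k w) = g (rightBasis k w)) (a : Alg k) : f a = g a :=
  LinearMap.congr_fun ((rightBasis k).ext h) a

theorem delU_mul_au (a : Alg k) : wordOp k delU (a * au k) = a := by
  refine Alg.linearMap_ext_right (f := wordOp k delU ∘ₗ LinearMap.mulRight k (au k))
    (g := .id) (fun w => ?_) a
  rcases w with (_ | _ | _ | _) | _ | _ <;> simp [rightBasis_mul_au, mulU, delU]

/-- Normal words split into those ending with `u` (with `b z x = b z u` counted among them), which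
`x` kills, and the rest, on which appending `x` is undone by `delX`. Hence `ax = 0` puts `a` in
`Au`. -/
theorem delU_mul_add_delX_mul (a : Alg k) :
    wordOp k delU a * au k + wordOp k delX (a * ax k) = a := by
  refine Alg.linearMap_ext_right (f := LinearMap.mulRight k (au k) ∘ₗ wordOp k delU +
    wordOp k delX ∘ₗ LinearMap.mulRight k (ax k)) (g := .id) (fun w => ?_) a
  rcases w with (_ | _ | (_ | _ | _ | _) | _) | (_ | _) | _ <;>
    simp [rightBasis_mul_au, rightBasis_mul_ax, mulU, mulX, delU, delX]

/-- The same dichotomy for words ending with `x`, which are exactly those killed by `z`. Hence `az =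
0` puts `a` in `Ax`. -/
theorem delX_mul_add_delZ_mul (a : Alg k) :
    wordOp k delX a * ax k + wordOp k delZ (a * az k) = a := by
  refine Alg.linearMap_ext_right (f := LinearMap.mulRight k (ax k) ∘ₗ wordOp k delX +
    wordOp k delZ ∘ₗ LinearMap.mulRight k (az k)) (g := .id) (fun w => ?_) a
  rcases w with (_ | _ | (_ | _ | _ | _) | _) | (_ | _) | _ <;>
    simp [rightBasis_mul_az, rightBasis_mul_ax, mulZ, mulX, delZ, delX]

theorem delU_mul_add_delX'_mul (a : Alg k) :
    wordOp k delU a * au k + wordOp k delX' (a * ax k) = a := by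
  refine Alg.linearMap_ext_right (f := LinearMap.mulRight k (au k) ∘ₗ wordOp k delU +
    wordOp k delX' ∘ₗ LinearMap.mulRight k (ax k)) (g := .id) (fun w => ?_) a
  rcases w with (_ | _ | (_ | _ | _ | _) | _) | (_ | _) | _ <;>
    simp [rightBasis_mul_au, rightBasis_mul_ax, mulU, mulX, delU, delX']

theorem delY_mul_ax (a : Alg k) : wordOp k delY (a * ax k) = 0 := by
  refine Alg.linearMap_ext_right (f := wordOp k delY ∘ₗ LinearMap.mulRight k (ax k))
    (g := 0) (fun w => ?_) a
  rcases w with (_ | _ | _ | _) | _ | _ <;>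
    simp [rightBasis_mul_ax, mulX, delY, delU]

theorem delY_mul_az (a : Alg k) : wordOp k delY (a * az k) = 0 := by
  refine Alg.linearMap_ext_right (f := wordOp k delY ∘ₗ LinearMap.mulRight k (az k))
    (g := 0) (fun w => ?_) a
  rcases w with (_ | _ | _ | _) | _ | _ <;>
    simp [rightBasis_mul_az, mulZ, delY, delU]

theorem delX'_mul_az (a : Alg k) : wordOp k delX' (a * az k) = 0 := by
  refine Alg.linearMap_ext_right (f := wordOp k delX' ∘ₗ LinearMap.mulRight k (az k))
    (g := 0) (fun w => ?_) a
  rcases w with (_ | _ | _ | _) | _ | _ <;>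
    simp [rightBasis_mul_az, mulZ, delX']

theorem delZ_mul_au (a : Alg k) : wordOp k delZ (a * au k) = 0 := by
  refine Alg.linearMap_ext_right (f := wordOp k delZ ∘ₗ LinearMap.mulRight k (au k))
    (g := 0) (fun w => ?_) a
  rcases w with (_ | _ | _ | _) | _ | _ <;>
    simp [rightBasis_mul_au, mulU, delZ]

/-- This is the reason for replacing `delX` by `delX'`: the new operator kills `ay = au - ax`.
Applied to `px + qy + rz` it therefore sees `p` only; `delY` and `delZ` isolate `q` and `r`
likewise. -/
theorem delX'_mul_au (a : Alg k) : wordOp k delX' (a * au k) = wordOp k delX' (a * ax k) := by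
  refine Alg.linearMap_ext_right (f := wordOp k delX' ∘ₗ LinearMap.mulRight k (au k))
    (g := wordOp k delX' ∘ₗ LinearMap.mulRight k (ax k)) (fun w => ?_) a
  rcases w with (_ | _ | _ | _) | _ | _ <;>
    simp [rightBasis_mul_au, rightBasis_mul_ax, mulU, mulX, delX']

/-- Since `delY` kills `ax`, the term `au` may be replaced by `ay`; so `ay = 0` puts `a` in `Az`. -/
theorem delY_mul_add_delZ_mul (a : Alg k) : wordOp k delY (a * au k) + wordOp k delZ a * az k = a := by
  refine Alg.linearMap_ext_right (f := wordOp k delY ∘ₗ LinearMap.mulRight k (au k) + LinearMap.mulRight k (az k) ∘ₗ wordOp k delZ)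
    (g := .id) (fun w => ?_) a
  rcases w with (_ | _ | _ | _) | _ | _ <;>
    simp [rightBasis_mul_au, rightBasis_mul_az, mulU, mulZ, delY, delU, delZ]

theorem delZ_mul_ax (a : Alg k) : wordOp k delZ (a * ax k) = 0 := by
  refine Alg.linearMap_ext_right (f := wordOp k delZ ∘ₗ LinearMap.mulRight k (ax k))
    (g := 0) (fun w => ?_) a
  rcases w with (_ | _ | _ | _) | _ | _ <;> simp [rightBasis_mul_ax, mulX, delZ]

/-! ### The weight of a word -/

/-- A weight on words that drops when a letter is deleted. -/
def RBase.weight : RBase → ℕ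
  | .nil => 0
  | .xu n => n + 2
  | .u b => b.weight + 2
  | .z b => b.weight + 1

/-- A weight on words that drops when a letter is deleted. -/
def RWord.weight : RWord → ℕ
  | base b => b.weight
  | xpow n => n + 1
  | zx b => b.weight + 2

/-- A partially defined map of words that lowers the weight. -/
def Lowers (f : RWord → Option RWord) : Prop :=
  ∀ w, ∀ w' ∈ f w, w'.weight < w.weight

theorem lowers_delU : Lowers delU := by
  rintro ((_ | _ | (_ | _ | _ | _) | _) | (_ | _) | _) w' h <;> simp [delU] at h <;> subst h <;>
    simp [RWord.weight, RBase.weight]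

theorem lowers_delX : Lowers delX := by
  rintro ((_ | _ | (_ | _ | _ | _) | _) | (_ | _) | _) w' h <;> simp [delX] at h <;> subst h <;>
    simp [RWord.weight, RBase.weight]

theorem lowers_delX' : Lowers delX' := by
  rintro ((_ | _ | (_ | _ | _ | _) | _) | (_ | _) | _) w' h <;> simp [delX'] at h <;> subst h <;>
    simp [RWord.weight, RBase.weight]

theorem lowers_delZ : Lowers delZ := by
  rintro ((_ | _ | (_ | _ | _ | _) | _) | (_ | _) | _) w' h <;> simp [delZ] at h
  subst h
  simp [RWord.weight, RBase.weight]

theorem lowers_delY : Lowers delY := by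
  rintro (_ | _ | _) w' h
  · exact lowers_delU _ _ h
  · exact lowers_delU _ _ h
  · simp [delY] at h

end KoszulExample

namespace KoszulExample

variable {k : Type u} [Field k]

/-! ### Normal words, built by multiplication on the left -/

/-- Normal words that do not start with `x`. The word `z t` stands for `z t`, or for `z x t` when
`t` starts with `u`. -/
inductive LTail : Type
  | nil
  | zx
  | u (t : LTail)
  | z (t : LTail)

/-- Normal words; `xu n t` stands for `xⁿ⁺¹ u t`. -/
inductive LWord : Type
  | tail (t : LTail)
  | xpow (n : ℕ)
  | xu (n : ℕ) (t : LTail)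

namespace LWord

/-- Multiplication by `x` on the left. -/
def mulX : LWord → Option LWord
  | tail .nil => some (xpow 0)
  | tail (.u t) => some (xu 0 t)
  | tail (.z _) => none
  | tail .zx => none
  | xpow n => some (xpow (n + 1))
  | xu n t => some (xu (n + 1) t)

/-- Multiplication by `u` on the left. -/
def mulU : LWord → Option LWord
  | tail t => some (tail (.u t))
  | xpow _ => none
  | xu _ _ => none

/-- Multiplication by `z` on the left. -/
def mulZ : LWord → Option LWord
  | tail .nil => some (tail (.z .nil))
  | tail .zx => some (tail (.z .zx))
  | tail (.z t) => some (tail (.z (.z t)))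
  | tail (.u .nil) => some (tail .zx)
  | tail (.u (.u t)) => some (tail (.z (.u t)))
  | tail (.u (.z _)) => none
  | tail (.u .zx) => none
  | xpow 0 => some (tail .zx)
  | xpow (_ + 1) => none
  | xu 0 t => some (tail (.z (.u t)))
  | xu (_ + 1) _ => none

end LWord

open LWord

/-- The value of a word in the algebra. -/
def LTail.eval (k : Type u) [Field k] : LTail → Alg k
  | .nil => 1
  | .zx => az k * ax k
  | .u t => au k * LTail.eval k t
  | .z .nil => az k
  | .z .zx => az k * (az k * ax k)
  | .z (.z t) => az k * LTail.eval k (.z t)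
  | .z (.u t) => az k * (ax k * (au k * LTail.eval k t))

/-- The value of a word in the algebra. -/
def LWord.eval (k : Type u) [Field k] : LWord → Alg k
  | tail t => t.eval k
  | xpow n => ax k ^ (n + 1)
  | xu n t => ax k ^ (n + 1) * (au k * t.eval k)

/-- The left regular representation in terms of normal words. -/
def leftRep (k : Type u) [Field k] : Alg k →ₐ[k] Module.End k (LWord →₀ k) :=
  liftXUZ (partialOp k mulX) (partialOp k mulU) (partialOp k mulZ)
    (by
      ext w : 1
      rcases w with (_ | _ | _ | _) | _ | _ <;> ext <;> simp [mulX, mulU])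
    (by
      ext w : 1
      rcases w with (_ | _ | (_ | _ | _ | _) | _) | (_ | _) | (_ | _) <;> ext <;>
        simp [mulX, mulZ])
    (by
      ext w : 1
      rcases w with (_ | _ | _ | _) | _ | _ <;> ext <;> simp [mulX, mulU, mulZ])

theorem az_mul_ax_mul_ax_mul (a : Alg k) : az k * (ax k * (ax k * a)) = 0 := by
  rw [← az_mul_au_mul, au_mul_ax_mul, mul_zero]

theorem LTail.ax_mul_eval_z (t : LTail) : ax k * (LTail.z t).eval k = 0 := by
  cases t <;> simp [LTail.eval]

theorem leftEval_mulX (w : LWord) : (w.mulX).elim 0 (LWord.eval k) = ax k * w.eval k := by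
  rcases w with (_ | _ | _ | _) | _ | _ <;>
    simp [LWord.mulX, LWord.eval, LTail.eval, pow_succ', mul_assoc, LTail.ax_mul_eval_z]

theorem leftEval_mulU (w : LWord) : (w.mulU).elim 0 (LWord.eval k) = au k * w.eval k := by
  rcases w with _ | _ | _ <;>
    simp [LWord.mulU, LWord.eval, LTail.eval, pow_succ', mul_assoc]

theorem leftEval_mulZ (w : LWord) : (w.mulZ).elim 0 (LWord.eval k) = az k * w.eval k := by
  rcases w with (_ | _ | (_ | _ | _ | _) | _) | (_ | _) | (_ | _) <;>
    simp [LWord.mulZ, LWord.eval, LTail.eval, pow_succ', mul_assoc, az_mul_au_mul, az_mul_au,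
      az_mul_ax_mul_ax_mul, LTail.ax_mul_eval_z]

/-- The linear map from formal combinations of words to the algebra. -/
def leftEval (k : Type u) [Field k] : (LWord →₀ k) →ₗ[k] Alg k :=
  Finsupp.linearCombination k (LWord.eval k)

theorem leftEval_partialOp {f : LWord → Option LWord} {g : Alg k}
    (h : ∀ w, (f w).elim 0 (LWord.eval k) = g * w.eval k) (v : LWord →₀ k) :
    leftEval k (partialOp k f v) = g * leftEval k v := by
  suffices leftEval k ∘ₗ partialOp k f = LinearMap.mulLeft k g ∘ₗ leftEval k from
    LinearMap.congr_fun this v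
  ext w
  have := h w
  cases hf : f w <;> simp_all [leftEval]

theorem leftEval_leftRep (a : Alg k) (v : LWord →₀ k) :
    leftEval k (leftRep k a v) = a * leftEval k v := by
  induction a using Alg.induction generalizing v with
  | base r => simp [Algebra.algebraMap_eq_smul_one]
  | add a b ha hb => simp [ha, hb, add_mul]
  | mul a b ha hb => simp [ha, hb, mul_assoc]
  | hg g =>
    cases g with
    | x => simp [leftRep, leftEval_partialOp leftEval_mulX]
    | y => simp [leftRep, leftEval_partialOp leftEval_mulX, leftEval_partialOp leftEval_mulU,
        sub_mul, ay_eq]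
    | z => simp [leftRep, leftEval_partialOp leftEval_mulZ]

/-- The coordinates of an element with respect to the normal words. -/
def leftCoord (k : Type u) [Field k] : Alg k →ₗ[k] (LWord →₀ k) :=
  (LinearMap.applyₗ (Finsupp.single (tail .nil) (1 : k))) ∘ₗ (leftRep k).toLinearMap

theorem leftCoord_apply (a : Alg k) :
    leftCoord k a = leftRep k a (Finsupp.single (tail .nil) 1) := rfl

theorem leftCoord_au_mul (a : Alg k) :
    leftCoord k (au k * a) = partialOp k mulU (leftCoord k a) := by
  simp [leftCoord_apply, leftRep]

theorem leftCoord_ax_mul (a : Alg k) :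
    leftCoord k (ax k * a) = partialOp k mulX (leftCoord k a) := by
  simp [leftCoord_apply, leftRep]

theorem leftCoord_az_mul (a : Alg k) :
    leftCoord k (az k * a) = partialOp k mulZ (leftCoord k a) := by
  simp [leftCoord_apply, leftRep]

theorem leftCoord_one : leftCoord k 1 = Finsupp.single (tail .nil) 1 := by
  simp [leftCoord_apply]

theorem leftCoord_ax : leftCoord k (ax k) = Finsupp.single (xpow 0) 1 := by
  rw [← mul_one (ax k), leftCoord_ax_mul, leftCoord_one]; simp [LWord.mulX]

theorem leftCoord_pow_mul (n : ℕ) (a : Alg k) (w : LWord) (f : ℕ → LWord)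
    (ha : leftCoord k a = Finsupp.single w 1) (h0 : w.mulX = some (f 0))
    (hs : ∀ n, (f n).mulX = some (f (n + 1))) :
    leftCoord k (ax k ^ (n + 1) * a) = Finsupp.single (f n) 1 := by
  induction n with
  | zero => rw [zero_add, pow_one, leftCoord_ax_mul, ha]; simp [h0]
  | succ n ih => rw [pow_succ', mul_assoc, leftCoord_ax_mul, ih]; simp [hs]

theorem leftCoord_evalTail (t : LTail) :
    leftCoord k (t.eval k) = Finsupp.single (tail t) 1 := by
  induction t using LTail.eval.induct with
  | case1 => simp [LTail.eval, leftCoord_one]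
  | case2 => simp [LTail.eval, leftCoord_az_mul, leftCoord_ax, LWord.mulZ]
  | case3 t ih => simp [LTail.eval, leftCoord_au_mul, ih, LWord.mulU]
  | case4 =>
    rw [LTail.eval, ← mul_one (az k), leftCoord_az_mul, leftCoord_one]; simp [LWord.mulZ]
  | case5 => simp [LTail.eval, leftCoord_az_mul, leftCoord_ax, LWord.mulZ]
  | case6 t ih => simp [LTail.eval, leftCoord_az_mul, ih, LWord.mulZ]
  | case7 t ih =>
    simp [LTail.eval, leftCoord_az_mul, leftCoord_ax_mul, leftCoord_au_mul, ih, LWord.mulZ,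
      LWord.mulX, LWord.mulU]

theorem leftCoord_eval (w : LWord) : leftCoord k (w.eval k) = Finsupp.single w 1 := by
  cases w with
  | tail t => exact leftCoord_evalTail t
  | xpow n =>
    rw [LWord.eval, ← mul_one (ax k ^ (n + 1))]
    exact leftCoord_pow_mul n 1 _ xpow leftCoord_one rfl fun _ => rfl
  | xu n t =>
    refine leftCoord_pow_mul n _ (tail (.u t)) (fun n => xu n t) ?_ rfl fun _ => rfl
    simp [leftCoord_au_mul, leftCoord_evalTail, LWord.mulU]

/-- The basis of normal words. -/
def leftBasis (k : Type u) [Field k] : Module.Basis LWord k (Alg k) :=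
  .ofRepr <| LinearEquiv.ofLinearMap (leftCoord k) (leftEval k)
    (by ext w : 2; simp [leftEval, leftCoord_eval])
    (by
      apply LinearMap.ext; intro a
      simp [leftCoord_apply, leftEval_leftRep]
      simp [leftEval, LWord.eval, LTail.eval])

theorem leftBasis_apply (w : LWord) : leftBasis k w = w.eval k := by
  simp [leftBasis, leftEval]

theorem ax_mul_leftBasis (w : LWord) :
    ax k * leftBasis k w = (w.mulX).elim 0 (leftBasis k) := by
  rw [leftBasis_apply, ← leftEval_mulX]
  cases w.mulX <;> simp [leftBasis_apply]

theorem au_mul_leftBasis (w : LWord) :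
    au k * leftBasis k w = (w.mulU).elim 0 (leftBasis k) := by
  rw [leftBasis_apply, ← leftEval_mulU]
  cases w.mulU <;> simp [leftBasis_apply]

theorem az_mul_leftBasis (w : LWord) :
    az k * leftBasis k w = (w.mulZ).elim 0 (leftBasis k) := by
  rw [leftBasis_apply, ← leftEval_mulZ]
  cases w.mulZ <;> simp [leftBasis_apply]

theorem Alg.linearMap_ext_left {V : Type*} [AddCommGroup V] [Module k V] {f g : Alg k →ₗ[k] V}
    (h : ∀ w, f (leftBasis k w) = g (leftBasis k w)) (a : Alg k) : f a = g a :=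
  LinearMap.congr_fun ((leftBasis k).ext h) a

/-! ### Annihilators on the left -/

/-- A left inverse of multiplication by `y` on the left. -/
def cancelY (k : Type u) [Field k] : Alg k →ₗ[k] Alg k :=
  (leftBasis k).constr k fun
    | tail (.u t) => leftBasis k (tail t)
    | xpow (n + 1) => - leftBasis k (xpow n)
    | xu (n + 1) t => - leftBasis k (xu n t)
    | _ => 0

/-- In `yw = uw - xw` a word `w` not starting with `x` is recovered from `uw`, and `cancelY` kills
the accompanying `xw`. If `w` starts with `x`, then `uw = 0` and `w` is recovered from `-xw`. -/
theorem cancelY_mul (a : Alg k) : cancelY k (ay k * a) = a := by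
  refine Alg.linearMap_ext_left (f := cancelY k ∘ₗ LinearMap.mulLeft k (ay k))
    (g := .id) (fun w => ?_) a
  simp only [LinearMap.comp_apply, LinearMap.mulLeft_apply, ay_eq, sub_mul, au_mul_leftBasis,
    ax_mul_leftBasis, LinearMap.id_apply, map_sub]
  rcases w with (_ | _ | _ | _) | _ | _ <;> simp [LWord.mulU, LWord.mulX, cancelY]

theorem exists_az_mul_of_ax_mul {a : Alg k} (h : ax k * a = 0) : ∃ b, a = az k * b := by
  -- `p` strips a leading `z` and `q` strips a leading `x`. Since `z (u t)` stands for `z x u t`,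
  -- its quotient by `z` is `x u t`.
  let p : Alg k →ₗ[k] Alg k := (leftBasis k).constr k fun
    | tail .zx => leftBasis k (xpow 0)
    | tail (.z (.u t)) => leftBasis k (xu 0 t)
    | tail (.z t) => leftBasis k (tail t)
    | _ => 0
  let q : Alg k →ₗ[k] Alg k := (leftBasis k).constr k fun
    | xpow 0 => leftBasis k (tail .nil)
    | xu 0 t => leftBasis k (tail (.u t))
    | xpow (n + 1) => leftBasis k (xpow n)
    | xu (n + 1) t => leftBasis k (xu n t)
    | _ => 0
  have key : az k * p a + q (ax k * a) = a := by
    refine Alg.linearMap_ext_left (f := LinearMap.mulLeft k (az k) ∘ₗ p +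
      q ∘ₗ LinearMap.mulLeft k (ax k)) (g := .id) (fun w => ?_) a
    rcases w with (_ | _ | _ | (_ | _ | _ | _)) | (_ | _) | (_ | _) <;>
      simp [ax_mul_leftBasis, az_mul_leftBasis, LWord.mulZ, LWord.mulX, p, q]
  exact ⟨p a, by simpa [h] using key.symm⟩

theorem exists_ay_mul_of_az_mul {a : Alg k} (h : az k * a = 0) : ∃ b, a = ay k * b := by
  -- Left multiplication by `z` identifies words starting with `x` and `u` through `zx = zu`. Here
  -- `q` always chooses the preimage starting with `u`, and `p` supplies the correction `x - u =
  -- -y`.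
  let p : Alg k →ₗ[k] Alg k := (leftBasis k).constr k fun
    | tail (.u (.z t)) => leftBasis k (tail (.z t))
    | tail (.u .zx) => leftBasis k (tail .zx)
    | xpow 0 => - leftBasis k (tail .nil)
    | xu 0 t => - leftBasis k (tail (.u t))
    | xpow (n + 1) => - leftBasis k (xpow n)
    | xu (n + 1) t => - leftBasis k (xu n t)
    | _ => 0
  let q : Alg k →ₗ[k] Alg k := (leftBasis k).constr k fun
    | tail .zx => leftBasis k (tail (.u .nil))
    | tail (.z (.u t)) => leftBasis k (tail (.u (.u t)))
    | tail (.z t) => leftBasis k (tail t)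
    | _ => 0
  have key : ay k * p a + q (az k * a) = a := by
    refine Alg.linearMap_ext_left (f := LinearMap.mulLeft k (ay k) ∘ₗ p +
      q ∘ₗ LinearMap.mulLeft k (az k)) (g := .id) (fun w => ?_) a
    simp only [LinearMap.add_apply, LinearMap.comp_apply, LinearMap.mulLeft_apply, ay_eq, sub_mul,
      az_mul_leftBasis, LinearMap.id_apply]
    rcases w with (_ | _ | (_ | _ | _ | _) | (_ | _ | _ | _)) | (_ | _) | (_ | _) <;>
      simp [ax_mul_leftBasis, au_mul_leftBasis, LWord.mulZ, LWord.mulX, LWord.mulU, p, q,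
        mul_neg (au k), mul_neg (ax k)]
  exact ⟨p a, by simpa [h] using key.symm⟩

end KoszulExample

namespace KoszulExample

open Hochschild RWord

variable (k : Type u) [Field k]

/-! ### The enveloping algebra -/

/-- The enveloping algebra. -/
abbrev EnvAlg : Type u := Env k (Alg k)

variable {k}

/-- Multiplication on the left factor. -/
def onL (a : Alg k) : EnvAlg k := a ⊗ₜ 1

/-- Multiplication on the right factor. -/
def onR (a : Alg k) : EnvAlg k := 1 ⊗ₜ op a

theorem onL_mul (a b : Alg k) : onL (a * b) = onL a * onL b := by simp [onL]
theorem onR_mul (a b : Alg k) : onR (a * b) = onR b * onR a := by simp [onR]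
theorem onL_add (a b : Alg k) : onL (a + b) = onL a + onL b := by simp [onL, add_tmul]
theorem onR_add (a b : Alg k) : onR (a + b) = onR a + onR b := by simp [onR, tmul_add]
@[simp] theorem onL_zero : onL (0 : Alg k) = 0 := by simp [onL]
@[simp] theorem onR_zero : onR (0 : Alg k) = 0 := by simp [onR]
theorem onR_mul_onL (a b : Alg k) : onR a * onL b = onL b * onR a := by simp [onL, onR]

/-- A linear endomorphism of the algebra, acting on the left factor. -/
def hat (f : Alg k →ₗ[k] Alg k) : EnvAlg k →ₗ[k] EnvAlg k := f.rTensor (Alg k)ᵐᵒᵖ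

@[simp] theorem hat_tmul (f : Alg k →ₗ[k] Alg k) (a : Alg k) (c : (Alg k)ᵐᵒᵖ) :
    hat f (a ⊗ₜ c : EnvAlg k) = f a ⊗ₜ c := rfl

/-- Operators on the left factor commute with multiplication on the right one; this lets the
deletion operators pass through the second half of each differential. -/
theorem hat_mul_onR (f : Alg k →ₗ[k] Alg k) (a : Alg k) (t : EnvAlg k) :
    hat f (t * onR a) = hat f t * onR a := by
  induction t using TensorProduct.induction_on with
  | zero => simp
  | tmul b c => simp [onR]
  | add s t hs ht => simp [add_mul, hs, ht]

theorem hat_delU_mul_au (t : EnvAlg k) : hat (wordOp k delU) (t * onL (au k)) = t := by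
  induction t using TensorProduct.induction_on with
  | zero => simp
  | tmul b c => simp [onL, delU_mul_au]
  | add s t hs ht => simp [add_mul, hs, ht]

theorem hat_delU_mul_add_delX_mul (t : EnvAlg k) :
    hat (wordOp k delU) t * onL (au k) + hat (wordOp k delX) (t * onL (ax k)) = t := by
  induction t using TensorProduct.induction_on with
  | zero => simp
  | tmul b c => simp [onL, ← add_tmul, delU_mul_add_delX_mul]
  | add s t hs ht =>
    conv_rhs => rw [← hs, ← ht]
    simp only [map_add, add_mul]; abel

theorem hat_delX_mul_add_delZ_mul (t : EnvAlg k) :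
    hat (wordOp k delX) t * onL (ax k) + hat (wordOp k delZ) (t * onL (az k)) = t := by
  induction t using TensorProduct.induction_on with
  | zero => simp
  | tmul b c => simp [onL, ← add_tmul, delX_mul_add_delZ_mul]
  | add s t hs ht =>
    conv_rhs => rw [← hs, ← ht]
    simp only [map_add, add_mul]; abel

theorem hat_delU_mul_add_delX'_mul (t : EnvAlg k) :
    hat (wordOp k delU) t * onL (au k) + hat (wordOp k delX') (t * onL (ax k)) = t := by
  induction t using TensorProduct.induction_on with
  | zero => simp
  | tmul b c => simp [onL, ← add_tmul, delU_mul_add_delX'_mul]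
  | add s t hs ht =>
    conv_rhs => rw [← hs, ← ht]
    simp only [map_add, add_mul]; abel

theorem hat_delX'_mul_ay (t : EnvAlg k) : hat (wordOp k delX') (t * onL (ay k)) = 0 := by
  induction t using TensorProduct.induction_on with
  | zero => simp
  | tmul b c => simp [onL, ay_eq, mul_sub, delX'_mul_au]
  | add s t hs ht => simp [add_mul, hs, ht]

theorem hat_delX'_mul_az (t : EnvAlg k) : hat (wordOp k delX') (t * onL (az k)) = 0 := by
  induction t using TensorProduct.induction_on with
  | zero => simp
  | tmul b c => simp [onL, delX'_mul_az]
  | add s t hs ht => simp [add_mul, hs, ht]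

theorem hat_delY_mul_ax (t : EnvAlg k) : hat (wordOp k delY) (t * onL (ax k)) = 0 := by
  induction t using TensorProduct.induction_on with
  | zero => simp
  | tmul b c => simp [onL, delY_mul_ax]
  | add s t hs ht => simp [add_mul, hs, ht]

theorem hat_delY_mul_az (t : EnvAlg k) : hat (wordOp k delY) (t * onL (az k)) = 0 := by
  induction t using TensorProduct.induction_on with
  | zero => simp
  | tmul b c => simp [onL, delY_mul_az]
  | add s t hs ht => simp [add_mul, hs, ht]

theorem hat_delY_mul_ay_add (t : EnvAlg k) :
    hat (wordOp k delY) (t * onL (ay k)) + hat (wordOp k delZ) t * onL (az k) = t := by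
  induction t using TensorProduct.induction_on with
  | zero => simp
  | tmul b c => simp [onL, ← add_tmul, ay_eq, mul_sub, delY_mul_ax, delY_mul_add_delZ_mul]
  | add s t hs ht =>
    conv_rhs => rw [← hs, ← ht]
    simp only [map_add, add_mul]; abel

theorem hat_delZ_mul_ax (t : EnvAlg k) : hat (wordOp k delZ) (t * onL (ax k)) = 0 := by
  induction t using TensorProduct.induction_on with
  | zero => simp
  | tmul b c => simp [onL, delZ_mul_ax]
  | add s t hs ht => simp [add_mul, hs, ht]

theorem hat_delZ_mul_ay (t : EnvAlg k) : hat (wordOp k delZ) (t * onL (ay k)) = 0 := by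
  induction t using TensorProduct.induction_on with
  | zero => simp
  | tmul b c => simp [onL, ay_eq, mul_sub, delZ_mul_au, delZ_mul_ax]
  | add s t hs ht => simp [add_mul, hs, ht]

theorem eq_zero_of_mul_onR_ay {t : EnvAlg k} (h : t * onR (ay k) = 0) : t = 0 := by
  let f : EnvAlg k →ₗ[k] EnvAlg k := LinearMap.lTensor (Alg k)
    ((opLinearEquiv k).toLinearMap ∘ₗ cancelY k ∘ₗ (opLinearEquiv k).symm.toLinearMap)
  have key : ∀ t, f (t * onR (ay k)) = t := by
    intro t
    induction t using TensorProduct.induction_on with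
    | zero => simp
    | tmul b c => simp [onR, f, cancelY_mul]
    | add s t hs ht => simp [add_mul, hs, ht]
  rw [← key t, h, map_zero]

theorem eq_zero_of_mul_onL_au {t : EnvAlg k} (h : t * onL (au k) = 0) : t = 0 := by
  rw [← hat_delU_mul_au t, h, map_zero]

/-! ### The weight filtration on the left factor -/

/-- The elements whose left factor has weight less than `m`. -/
def filt (k : Type u) [Field k] (m : ℕ) : Submodule k (EnvAlg k) :=
  Submodule.span k {t | ∃ (w : RWord) (c : (Alg k)ᵐᵒᵖ), w.weight < m ∧ t = rightBasis k w ⊗ₜ c}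

theorem filt_mono : Monotone (filt k) := fun _ _ h =>
  Submodule.span_mono fun _ ⟨w, c, hw, ht⟩ => ⟨w, c, hw.trans_le h, ht⟩

theorem filt_zero : filt k 0 = ⊥ := by simp [filt]

theorem exists_mem_filt (t : EnvAlg k) : ∃ m, t ∈ filt k m := by
  induction t using TensorProduct.induction_on with
  | zero => exact ⟨0, zero_mem _⟩
  | add s t hs ht =>
    obtain ⟨m, hm⟩ := hs
    obtain ⟨n, hn⟩ := ht
    exact ⟨max m n, add_mem (filt_mono (le_max_left _ _) hm) (filt_mono (le_max_right _ _) hn)⟩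
  | tmul b c =>
    have hb := (rightBasis k).mem_span b
    induction hb using Submodule.span_induction with
    | mem b hb =>
      obtain ⟨w, rfl⟩ := hb
      exact ⟨w.weight + 1, Submodule.subset_span ⟨w, c, Nat.lt_succ_self _, rfl⟩⟩
    | zero => exact ⟨0, by simp⟩
    | add s t _ _ hs ht =>
      obtain ⟨m, hm⟩ := hs
      obtain ⟨n, hn⟩ := ht
      rw [add_tmul]
      exact ⟨max m n, add_mem (filt_mono (le_max_left _ _) hm) (filt_mono (le_max_right _ _) hn)⟩
    | smul r s _ hs =>
      obtain ⟨m, hm⟩ := hs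
      exact ⟨m, by rw [← smul_tmul']; exact Submodule.smul_mem _ _ hm⟩

theorem mul_onR_mem_filt {m : ℕ} {t : EnvAlg k} (ht : t ∈ filt k m) (a : Alg k) :
    t * onR a ∈ filt k m := by
  induction ht using Submodule.span_induction with
  | mem t ht =>
    obtain ⟨w, c, hw, rfl⟩ := ht
    exact Submodule.subset_span ⟨w, c * op a, hw, by simp [onR]⟩
  | zero => simp
  | add s t _ _ hs ht => rw [add_mul]; exact add_mem hs ht
  | smul r t _ ht => rw [smul_mul_assoc]; exact Submodule.smul_mem _ _ ht

theorem hat_mem_filt {f : RWord → Option RWord} (hf : Lowers f) {m : ℕ} {t : EnvAlg k}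
    (ht : t ∈ filt k (m + 1)) : hat (wordOp k f) t ∈ filt k m := by
  induction ht using Submodule.span_induction with
  | mem t ht =>
    obtain ⟨w, c, hw, rfl⟩ := ht
    rw [hat_tmul, wordOp_basis]
    cases h : f w with
    | none => simp
    | some w' =>
      exact Submodule.subset_span ⟨w', c, by have := hf w w' h; omega, rfl⟩
  | zero => simp
  | add s t _ _ hs ht => rw [map_add]; exact add_mem hs ht
  | smul r t _ ht => rw [map_smul]; exact Submodule.smul_mem _ _ ht

end KoszulExample

namespace KoszulExample

open Hochschild RWord

variable {k : Type u} [Field k]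

/-! ### Exactness of the Koszul bimodule complex -/

/-- From `t x = 0` comes `t = e u` on the left factor; the first equation then determines `s`,
because right multiplication by `u` is injective there. -/
theorem exact_three {s t : EnvAlg k} (h1 : s * onL (au k) = t * onR (ay k))
    (h2 : t * onL (ax k) = 0) : ∃ e, s = e * onR (ay k) ∧ t = e * onL (au k) := by
  have ht : t = hat (wordOp k delU) t * onL (au k) := by
    simpa [h2] using (hat_delU_mul_add_delX_mul t).symm
  refine ⟨hat (wordOp k delU) t, sub_eq_zero.1 (eq_zero_of_mul_onL_au ?_), ht⟩
  rw [sub_mul, h1, mul_assoc, onR_mul_onL, ← mul_assoc, ← ht, sub_self]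

/-- Dividing `b` by `u` leaves a remainder that `h3` turns into a multiple of `onR y`. The values of
`c` and then `a` follow by cancelling `onR y` and `onL u`. -/
theorem exact_two {a b c : EnvAlg k}
    (h1 : a * onL (au k) + b * onR (az k) + a * onR (ax k) = 0)
    (h2 : c * onL (az k) + a * onR (ax k) = 0)
    (h3 : b * onL (ax k) + c * onR (ay k) = 0) :
    ∃ s t, a = - (s * onR (az k)) ∧ b = s * onL (au k) - t * onR (ay k) ∧
      c = t * onL (ax k) := by
  set s := hat (wordOp k delU) b
  set t := hat (wordOp k delX) c
  have hb : b = s * onL (au k) - t * onR (ay k) := by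
    conv_lhs => rw [← hat_delU_mul_add_delX_mul b, eq_neg_of_add_eq_zero_left h3, map_neg,
      hat_mul_onR]
    exact (sub_eq_add_neg _ _).symm
  have hc : c = t * onL (ax k) := by
    refine sub_eq_zero.1 (eq_zero_of_mul_onR_ay ?_)
    rw [sub_mul, eq_neg_of_add_eq_zero_right h3, hb, sub_mul, mul_assoc s, ← onL_mul, mul_assoc t,
      mul_assoc t, onR_mul_onL]
    simp
  refine ⟨s, t, eq_neg_of_add_eq_zero_left (eq_zero_of_mul_onL_au ?_), hb, hc⟩
  -- Now `c` is a left multiple of `onL x`, so `xz = 0` removes the other term of `h2`.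
  have h4 : a * onR (ax k) = 0 := by
    rw [hc, mul_assoc, ← onL_mul] at h2
    simpa using h2
  rw [h4, add_zero, hb, sub_mul, mul_assoc t, ← onR_mul] at h1
  rw [add_mul, mul_assoc s, onR_mul_onL, ← mul_assoc]
  simpa using h1

/-- The first differential of the Koszul complex. -/
def koszulOne (p q r : EnvAlg k) : EnvAlg k :=
  p * onL (ax k) + q * onL (ay k) + r * onL (az k) -
    (p * onR (ax k) + q * onR (ay k) + r * onR (az k))

/-- The composite of the first two differentials, with primes for the right factor, written as
multiples of the relations and of commutators between the two factors. -/
theorem koszul_expansion {R : Type*} [Ring R] (a b c x y z x' y' z' : R) :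
    (a * (x + y) + b * z' + a * x') * x + (c * z + a * x') * y + (b * x + c * y') * z -
      ((a * (x + y) + b * z' + a * x') * x' + (c * z + a * x') * y' + (b * x + c * y') * z') =
    a * (x * x + y * x) + b * (x * z) + c * (z * y) - a * (x' * x' + x' * y') - b * (z' * x') -
      c * (y' * z') + a * (x' * x - x * x') + a * (x' * y - y * x') + b * (z' * x - x * z') +
      c * (y' * z - z * y') := by
  noncomm_ring

theorem koszulOne_two (a b c : EnvAlg k) :
    koszulOne (a * onL (au k) + b * onR (az k) + a * onR (ax k))
      (c * onL (az k) + a * onR (ax k)) (b * onL (ax k) + c * onR (ay k)) = 0 := by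
  have hL : onL (au k) = onL (ax k) + onL (ay k) := onL_add _ _
  have h1 : onL (ax k) * onL (ax k) + onL (ay k) * onL (ax k) = 0 := by
    rw [← add_mul, ← hL, ← onL_mul]; simp
  have h2 : onL (ax k) * onL (az k) = 0 := by rw [← onL_mul]; simp
  have h3 : onL (az k) * onL (ay k) = 0 := by rw [← onL_mul]; simp
  have h4 : onR (ax k) * onR (ax k) + onR (ax k) * onR (ay k) = 0 := by
    rw [← mul_add, ← onR_add, ← onR_mul]; exact (congrArg onR (au_mul_ax k)).trans onR_zero
  have h5 : onR (az k) * onR (ax k) = 0 := by rw [← onR_mul]; simp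
  have h6 : onR (ay k) * onR (az k) = 0 := by rw [← onR_mul]; simp
  rw [koszulOne, hL, koszul_expansion, h1, h2, h3, h4, h5, h6]
  simp [onR_mul_onL]

theorem koszulOne_sub (p q r p' q' r' : EnvAlg k) :
    koszulOne (p - p') (q - q') (r - r') = koszulOne p q r - koszulOne p' q' r' := by
  simp only [koszulOne, sub_mul]; abel

/-- Successive approximation: subtracting a suitable boundary from a cycle lowers the weight of its
left factors, and weight below 0 means zero. -/
theorem exact_one_of_mem_filt (m : ℕ) {p q r : EnvAlg k} (hp : p ∈ filt k m) (hq : q ∈ filt k m)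
    (hr : r ∈ filt k m) (h : koszulOne p q r = 0) :
    ∃ a b c, p = a * onL (au k) + b * onR (az k) + a * onR (ax k) ∧
      q = c * onL (az k) + a * onR (ax k) ∧ r = b * onL (ax k) + c * onR (ay k) := by
  induction m generalizing p q r with
  | zero =>
    rw [filt_zero, Submodule.mem_bot] at hp hq hr
    exact ⟨0, 0, 0, by simp [hp], by simp [hq], by simp [hr]⟩
  | succ m ih =>
    -- The quotients of `p`, `r`, `q` by `u`, `x`, `z` on the left factor: the leading terms of the
    -- desired preimage.
    set a := hat (wordOp k delU) p
    set b := hat (wordOp k delX) r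
    set c := hat (wordOp k delZ) q
    have ha : a ∈ filt k m := hat_mem_filt lowers_delU hp
    have hb : b ∈ filt k m := hat_mem_filt lowers_delX hr
    have hc : c ∈ filt k m := hat_mem_filt lowers_delZ hq
    have hR (g) : ∀ {t}, t ∈ filt k m → t * onR g ∈ filt k m := fun ht => mul_onR_mem_filt ht g
    have h' := sub_eq_zero.1 h
    -- The cycle condition trades left multiplications for right ones, which preserve the
    -- filtration, so a deletion operator strictly lowers the weight of the sum.
    have key (f) (hf : Lowers f) : hat (wordOp k f) (p * onL (ax k)) +
        hat (wordOp k f) (q * onL (ay k)) + hat (wordOp k f) (r * onL (az k)) ∈ filt k m := by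
      rw [← map_add, ← map_add, h', map_add, map_add, hat_mul_onR, hat_mul_onR, hat_mul_onR]
      exact add_mem (add_mem (hR _ (hat_mem_filt hf hp)) (hR _ (hat_mem_filt hf hq)))
        (hR _ (hat_mem_filt hf hr))
    have kp := key delX' lowers_delX'
    rw [hat_delX'_mul_ay, hat_delX'_mul_az, add_zero, add_zero] at kp
    have kq := key delY lowers_delY
    rw [hat_delY_mul_ax, hat_delY_mul_az, add_zero, zero_add] at kq
    have kr := key delZ lowers_delZ
    rw [hat_delZ_mul_ax, hat_delZ_mul_ay, zero_add, zero_add] at kr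
    have ep := hat_delU_mul_add_delX'_mul p
    have eq := hat_delY_mul_ay_add q
    have er := hat_delX_mul_add_delZ_mul r
    obtain ⟨a', b', c', h1, h2, h3⟩ := ih
      (p := p - (a * onL (au k) + b * onR (az k) + a * onR (ax k)))
      (q := q - (c * onL (az k) + a * onR (ax k))) (r := r - (b * onL (ax k) + c * onR (ay k)))
      (by
        -- The remainder `p - a u` is `delX'` of `p x`, of lower weight by `kp`; the other two terms
        -- have lower weight because `a` and `b` do.
        rw [← sub_sub, ← sub_sub, ← eq_sub_of_add_eq' ep]
        exact sub_mem (sub_mem kp (hR _ hb)) (hR _ ha))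
      (by
        rw [← sub_sub, ← eq_sub_of_add_eq eq]
        exact sub_mem kq (hR _ ha))
      (by
        rw [← sub_sub, ← eq_sub_of_add_eq' er]
        exact sub_mem kr (hR _ hc))
      (by rw [koszulOne_sub, h, koszulOne_two, sub_self])
    refine ⟨a + a', b + b', c + c', ?_, ?_, ?_⟩
    · rw [sub_eq_iff_eq_add] at h1
      rw [h1]; simp only [add_mul]; abel
    · rw [sub_eq_iff_eq_add] at h2
      rw [h2]; simp only [add_mul]; abel
    · rw [sub_eq_iff_eq_add] at h3
      rw [h3]; simp only [add_mul]; abel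

theorem exact_one {p q r : EnvAlg k} (h : koszulOne p q r = 0) :
    ∃ a b c, p = a * onL (au k) + b * onR (az k) + a * onR (ax k) ∧
      q = c * onL (az k) + a * onR (ax k) ∧ r = b * onL (ax k) + c * onR (ay k) := by
  obtain ⟨l, hl⟩ := exists_mem_filt p
  obtain ⟨m, hm⟩ := exists_mem_filt q
  obtain ⟨n, hn⟩ := exists_mem_filt r
  exact exact_one_of_mem_filt (max l (max m n)) (filt_mono (by simp) hl)
    (filt_mono (by simp) hm) (filt_mono (by simp) hn) h

theorem koszulOne_add (p q r p' q' r' : EnvAlg k) :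
    koszulOne (p + p') (q + q') (r + r') = koszulOne p q r + koszulOne p' q' r' := by
  simp only [koszulOne, add_mul]; abel

theorem mul_koszulOne (e p q r : EnvAlg k) :
    e * koszulOne p q r = koszulOne (e * p) (e * q) (e * r) := by
  simp only [koszulOne, mul_add, mul_sub, mul_assoc]

theorem exists_koszulOne_eq (a : Alg k) : ∃ p q r, onL a - onR a = koszulOne p q r := by
  induction a using Alg.induction with
  | base r =>
    refine ⟨0, 0, 0, ?_⟩
    have : onL (algebraMap k _ r) = onR (algebraMap k (Alg k) r) := by
      simp [onL, onR, Algebra.algebraMap_eq_smul_one, smul_tmul]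
    simp [koszulOne, this]
  | hg g =>
    cases g with
    | x => exact ⟨1, 0, 0, by simp [koszulOne]⟩
    | y => exact ⟨0, 1, 0, by simp [koszulOne]⟩
    | z => exact ⟨0, 0, 1, by simp [koszulOne]⟩
  | add a b ha hb =>
    obtain ⟨p, q, r, h⟩ := ha
    obtain ⟨p', q', r', h'⟩ := hb
    exact ⟨p + p', q + q', r + r', by rw [koszulOne_add, ← h, ← h', onL_add, onR_add]; abel⟩
  | mul a b ha hb =>
    obtain ⟨p, q, r, h⟩ := ha
    obtain ⟨p', q', r', h'⟩ := hb
    -- Leibniz rule: `ab ⊗ 1 - 1 ⊗ ab = (1 ⊗ b)(a ⊗ 1 - 1 ⊗ a) + (a ⊗ 1)(b ⊗ 1 - 1 ⊗ b)`.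
    refine ⟨onR b * p + onL a * p', onR b * q + onL a * q', onR b * r + onL a * r', ?_⟩
    rw [koszulOne_add, ← mul_koszulOne, ← mul_koszulOne, ← h, ← h', onL_mul, onR_mul, mul_sub,
      mul_sub, onR_mul_onL]
    abel

/-- Modulo boundaries every left factor can be moved to the right, leaving only the product
`AlgHom.mulLeftRight k (Alg k) t 1` of the two factors. -/
theorem exists_sub_koszulOne (t : EnvAlg k) : ∃ p q r,
    t = koszulOne p q r + onR (AlgHom.mulLeftRight k (Alg k) t 1) := by
  induction t using TensorProduct.induction_on with
  | zero => exact ⟨0, 0, 0, by simp [koszulOne]⟩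
  | tmul a c =>
    obtain ⟨p, q, r, h⟩ := exists_koszulOne_eq a
    refine ⟨onR c.unop * p, onR c.unop * q, onR c.unop * r, ?_⟩
    rw [← mul_koszulOne, ← h]
    simp [onL, onR, mul_sub]
  | add s t hs ht =>
    obtain ⟨p, q, r, h⟩ := hs
    obtain ⟨p', q', r', h'⟩ := ht
    refine ⟨p + p', q + q', r + r', ?_⟩
    rw [koszulOne_add, map_add, LinearMap.add_apply, onR_add]
    conv_lhs => rw [h, h']
    abel

theorem exact_zero {t : EnvAlg k} (h : AlgHom.mulLeftRight k (Alg k) t 1 = 0) :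
    ∃ p q r, t = koszulOne p q r := by
  obtain ⟨p, q, r, e⟩ := exists_sub_koszulOne t
  exact ⟨p, q, r, by simpa [h] using e⟩

/-! ### Hochschild chains -/

theorem hochschild_four {a : Alg k} (h : a * au k = 0) : a = 0 := by
  rw [← delU_mul_au a, h, map_zero]

/-- As in `exact_three`, with left multiplication by `y` in place of `onR y`. -/
theorem hochschild_three {a b : Alg k} (h1 : b * ax k = 0) (h2 : a * au k = ay k * b) :
    ∃ c, a = ay k * c ∧ b = c * au k := by
  have hb : b = wordOp k delU b * au k := by simpa [h1] using (delU_mul_add_delX_mul b).symm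
  refine ⟨wordOp k delU b, sub_eq_zero.1 (hochschild_four ?_), hb⟩
  rw [sub_mul, h2, mul_assoc, ← hb, sub_self]

theorem hochschild_two {a b c : Alg k} (h1 : a * au k + az k * b + ax k * a = 0)
    (h2 : c * az k + ax k * a = 0) (h3 : b * ax k + ay k * c = 0) :
    ∃ s t, a = - (az k * s) ∧ b = s * au k - ay k * t ∧ c = t * ax k := by
  -- By `h3`, `y(cz) = -bxz = 0`, and left multiplication by `y` is injective.
  have hcz : c * az k = 0 := by
    rw [← cancelY_mul (c * az k), ← mul_assoc, eq_neg_of_add_eq_zero_right h3,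
      neg_mul (b * ax k), mul_ax_mul_az, neg_zero, map_zero]
  obtain ⟨t, rfl⟩ : ∃ t, c = t * ax k :=
    ⟨wordOp k delX c, by simpa [hcz] using (delX_mul_add_delZ_mul c).symm⟩
  have hxa : ax k * a = 0 := by simpa [hcz] using h2
  obtain ⟨s, rfl⟩ := exists_az_mul_of_ax_mul hxa
  -- With `a = zs` and `xa = 0`, `h1` reads `z(su + b) = 0`; the term `yt` is harmless since `zy =
  -- 0`.
  obtain ⟨f, hf⟩ : ∃ f, b + s * au k + ay k * t = ay k * f := by
    refine exists_ay_mul_of_az_mul ?_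
    rw [hxa, add_zero] at h1
    rw [mul_add, mul_add, ← mul_assoc, ← mul_assoc, az_mul_ay, zero_mul, add_zero, add_comm, ← h1]
  have hfx : f * ax k = 0 := by
    rw [← cancelY_mul (f * ax k), ← mul_assoc, ← hf, add_mul, add_mul, mul_au_mul_ax, add_zero,
      mul_assoc, h3, map_zero]
  -- Replacing `t` by `t - f` absorbs the error `yf` in `b` and leaves `c = tx` unchanged, because
  -- `fx = 0`.
  refine ⟨-s, t - f, by rw [mul_neg (az k), neg_neg], ?_, by rw [sub_mul, hfx, sub_zero]⟩
  rw [mul_sub, ← hf, neg_mul s]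
  abel

end KoszulExample

namespace NCTor

/-! ### Tor from a resolution by free modules of finite rank -/

section Coordinates

variable (k : Type u) [Field k] {R : Type u} [Ring R] [Algebra k R]

/-- The class of an elementary tensor. -/
def BalancedTensor.mk {M : ModuleCat.{u} Rᵐᵒᵖ} {N : ModuleCat.{u} R} (m : M) (n : N) :
    BalancedTensor k M N :=
  (balancing k M N).mkQ (m ⊗ₜ[k] n)

variable {k} {M : ModuleCat.{u} Rᵐᵒᵖ} {N N' : ModuleCat.{u} R}

theorem BalancedTensor.mk_smul (m : M) (r : R) (n : N) :
    BalancedTensor.mk k m (r • n) = BalancedTensor.mk k (op r • m) n := by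
  refine ((Submodule.Quotient.eq _).2 ?_).symm
  exact Submodule.subset_span ⟨m, r, n, rfl⟩

theorem BalancedTensor.mk_sum {ι : Type*} (s : Finset ι) (m : M) (f : ι → N) :
    BalancedTensor.mk k m (∑ i ∈ s, f i) = ∑ i ∈ s, BalancedTensor.mk k m (f i) := by
  simp only [BalancedTensor.mk, TensorProduct.tmul_sum, map_sum]

theorem BalancedTensor.sum_mk {ι : Type*} (s : Finset ι) (m : ι → M) (n : N) :
    BalancedTensor.mk k (∑ i ∈ s, m i) n = ∑ i ∈ s, BalancedTensor.mk k (m i) n := by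
  simp only [BalancedTensor.mk, TensorProduct.sum_tmul, map_sum]

theorem BalancedTensor.add_mk (m m' : M) (n : N) :
    BalancedTensor.mk k (m + m') n = BalancedTensor.mk k m n + BalancedTensor.mk k m' n := by
  simp only [BalancedTensor.mk, TensorProduct.add_tmul, map_add]

variable {ι κ : Type} (b : Module.Basis ι R N) (b' : Module.Basis κ R N')

/-- The coordinates of a tensor with respect to a basis of the right factor. -/
def coord (k : Type u) [Field k] [Algebra k R] (M : ModuleCat.{u} Rᵐᵒᵖ)
    (b : Module.Basis ι R N) : BalancedTensor k M N →ₗ[k] (ι → M) :=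
  Submodule.liftQ _ (TensorProduct.lift <| LinearMap.mk₂ k
      (fun (m : M) (v : N) (i : ι) => op (b.repr v i) • m)
      (fun m m' v => by ext i; simp)
      (fun c m v => by ext i; exact smul_comm _ _ _)
      (fun m v w => by ext i; simp [add_smul])
      (fun c m v => by
        ext i
        rw [← algebraMap_smul R c v]
        simp only [map_smul, Finsupp.smul_apply, smul_eq_mul, op_mul, Pi.smul_apply]
        rw [← algebraMap_smul Rᵐᵒᵖ c (op (b.repr v i) • m), ← mul_smul,
          MulOpposite.algebraMap_apply, ← op_mul, ← op_mul, Algebra.commutes])) (by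
    refine Submodule.span_le.2 ?_
    rintro _ ⟨m, r, v, rfl⟩
    simp only [SetLike.mem_coe, LinearMap.mem_ker, map_sub, TensorProduct.lift.tmul,
      LinearMap.mk₂_apply]
    ext i
    simp [mul_smul])

theorem coord_mk (m : M) (v : N) (i : ι) :
    coord k M b (BalancedTensor.mk k m v) i = op (b.repr v i) • m := rfl

variable [Fintype ι] [Fintype κ]

/-- The tensor with prescribed coordinates with respect to a basis of the right factor. -/
def ofCoord (k : Type u) [Field k] [Algebra k R] (b : Module.Basis ι R N) (m : ι → M) :
    BalancedTensor k M N :=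
  ∑ i, BalancedTensor.mk k (m i) (b i)

theorem mk_eq_ofCoord (m : M) (v : N) :
    BalancedTensor.mk k m v = ofCoord k b fun i => op (b.repr v i) • m := by
  conv_lhs => rw [← b.sum_repr v, BalancedTensor.mk_sum]
  exact Finset.sum_congr rfl fun i _ => BalancedTensor.mk_smul _ _ _

theorem exists_eq_ofCoord (x : BalancedTensor k M N) : ∃ m, x = ofCoord k b m := by
  obtain ⟨t, rfl⟩ := Submodule.mkQ_surjective _ x
  induction t using TensorProduct.induction_on with
  | zero => exact ⟨0, by simp [ofCoord, BalancedTensor.mk]⟩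
  | tmul m v => exact ⟨_, mk_eq_ofCoord b m v⟩
  | add s t hs ht =>
    obtain ⟨m, hm⟩ := hs
    obtain ⟨n, hn⟩ := ht
    refine ⟨m + n, ?_⟩
    rw [map_add, hm, hn]
    simp only [ofCoord, Pi.add_apply, BalancedTensor.add_mk, Finset.sum_add_distrib]

/-- Together with `exists_eq_ofCoord` this identifies `M ⊗_R N` with `M^ι` when `N` is free on `ι`.
-/
theorem coord_ofCoord (m : ι → M) : coord k M b (ofCoord k b m) = m := by
  classical
  ext j
  simp only [ofCoord, map_sum, Finset.sum_apply, coord_mk]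
  rw [Finset.sum_eq_single j] <;> simp +contextual

theorem map_ofCoord (f : N ⟶ N') (m : ι → M) :
    BalancedTensor.map k M f (ofCoord k b m) =
      ofCoord k b' fun j => ∑ i, op (b'.repr (f (b i)) j) • m i := by
  simp only [ofCoord, BalancedTensor.sum_mk, map_sum]
  rw [Finset.sum_comm]
  exact Finset.sum_congr rfl fun i _ => mk_eq_ofCoord b' (m i) (f (b i))

end Coordinates

/-! ### Free resolutions given by matrices acting on row vectors -/

section Resolution

/-- The action of a matrix on a free module of finite rank, as a morphism. -/
def matrixHom {R : Type u} [Ring R] {ι κ : Type} [Fintype ι] (D : Matrix ι κ R) :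
    ModuleCat.of R (ι → R) ⟶ ModuleCat.of R (κ → R) :=
  ModuleCat.ofHom (Matrix.vecMulLinear D)

theorem map_matrixHom_ofCoord {k : Type u} [Field k] {R : Type u} [Ring R] [Algebra k R]
    {M : ModuleCat.{u} Rᵐᵒᵖ} {ι κ : Type} [Fintype ι] [Fintype κ]
    (D : Matrix ι κ R) (m : ι → M) :
    BalancedTensor.map k M (matrixHom D)
        (ofCoord k (N := ModuleCat.of R (ι → R)) (Pi.basisFun R ι) m) =
      ofCoord k (N := ModuleCat.of R (κ → R)) (Pi.basisFun R κ)
        fun j => ∑ i, op (D i j) • m i := by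
  classical
  rw [map_ofCoord (N := ModuleCat.of R (ι → R)) (N' := ModuleCat.of R (κ → R))
    (Pi.basisFun R ι) (Pi.basisFun R κ)]
  congr! 4 with j i
  refine congrArg op ?_
  change Matrix.vecMul (Pi.basisFun R ι i) D j = _
  simp

variable {R : Type u} [Ring R] {r : ℕ → ℕ}

/-- The complex of free modules with differentials given by matrices. -/
def matrixComplex (D : ∀ n, Matrix (Fin (r (n + 1))) (Fin (r n)) R)
    (hD : ∀ n v, Matrix.vecMul (Matrix.vecMul v (D (n + 1))) (D n) = 0) : ChainComplex (ModuleCat.{u} R) ℕ :=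
  ChainComplex.of (fun n => ModuleCat.of R (Fin (r n) → R)) (fun n => matrixHom (D n)) fun n => by
    ext1
    refine LinearMap.ext fun (v : Fin (r (n + 2)) → R) => ?_
    exact hD n v

variable (D : ∀ n, Matrix (Fin (r (n + 1))) (Fin (r n)) R) (hD : ∀ n v, Matrix.vecMul (Matrix.vecMul v (D (n + 1))) (D n) = 0)

theorem matrixComplex_d (n : ℕ) : (matrixComplex D hD).d (n + 1) n = matrixHom (D n) :=
  ChainComplex.of_d (fun n => ModuleCat.of R (Fin (r n) → R)) (fun n => matrixHom (D n)) n

variable {N : ModuleCat.{u} R} (e : (Fin (r 0) → R) →ₗ[R] N)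
  (he : ∀ v, e (Matrix.vecMul v (D 0)) = 0)

/-- The augmentation of a complex of free modules. -/
def matrixComplexπ : matrixComplex D hD ⟶ (ChainComplex.single₀ (ModuleCat.{u} R)).obj N :=
  ((matrixComplex D hD).toSingle₀Equiv N).symm ⟨ModuleCat.ofHom e, by
    rw [matrixComplex_d]
    ext1
    exact LinearMap.ext he⟩

/-- An exact complex of free modules of finite rank is a projective resolution. -/
def matrixResolution (hs : Function.Surjective e)
    (h0 : ∀ v, e v = 0 → ∃ w, Matrix.vecMul w (D 0) = v)
    (h : ∀ n v, Matrix.vecMul v (D n) = 0 → ∃ w, Matrix.vecMul w (D (n + 1)) = v) :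
    ProjectiveResolution N where
  complex := matrixComplex D hD
  projective n := ModuleCat.projective_of_free (Pi.basisFun R (Fin (r n)))
  π := matrixComplexπ D hD e he
  quasiIso := ⟨fun n => by
    cases n with
    | zero =>
      -- In degree 0 a quasi-isomorphism onto `N` amounts to exactness at the last free module and
      -- surjectivity of the augmentation.
      rw [ChainComplex.quasiIsoAt₀_iff, ShortComplex.quasiIso_iff_of_zeros' _ rfl rfl rfl]
      constructor
      · rw [ShortComplex.moduleCat_exact_iff]
        intro v hv
        obtain ⟨w, hw⟩ := h0 v hv
        refine ⟨w, ?_⟩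
        change (matrixComplex D hD).d (0 + 1) 0 w = v
        rw [matrixComplex_d]
        exact hw
      · rw [ModuleCat.epi_iff_surjective]
        exact hs
    | succ n =>
      rw [quasiIsoAt_iff_exactAt' (hL := ChainComplex.exactAt_succ_single_obj ..),
        HomologicalComplex.exactAt_iff' _ (n + 2) (n + 1) n (by simp) (by simp),
        ShortComplex.moduleCat_exact_iff]
      intro v hv
      change (matrixComplex D hD).d (n + 1) n v = 0 at hv
      rw [matrixComplex_d] at hv
      obtain ⟨w, hw⟩ := h n v hv
      refine ⟨w, ?_⟩
      change (matrixComplex D hD).d (n + 2) (n + 1) w = v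
      rw [matrixComplex_d]
      exact hw⟩

variable (k : Type u) [Field k] [Algebra k R] (M : ModuleCat.{u} Rᵐᵒᵖ)

/-- In coordinates, tensoring with `M` turns the complex into powers of `M` with the same matrices
acting from the right, so only exactness of that complex at one spot is needed. -/
theorem isZero_tor_of_exact (P : ProjectiveResolution N) (hP : P.complex = matrixComplex D hD)
    (n : ℕ) (hM : ∀ m : Fin (r (n + 1)) → M, (∀ j, ∑ i, op (D n i j) • m i = 0) →
      ∃ m' : Fin (r (n + 2)) → M, ∀ i, m i = ∑ l, op (D (n + 1) l i) • m' l) :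
    Limits.IsZero (Tor k (n + 1) M N) := by
  refine Limits.IsZero.of_iso ?_ (P.isoLeftDerivedObj (tensorFunctor k M) (n + 1))
  rw [hP]
  refine HomologicalComplex.ExactAt.isZero_homology ?_
  rw [HomologicalComplex.exactAt_iff' _ (n + 2) (n + 1) n (by simp) (by simp),
    ShortComplex.moduleCat_exact_iff]
  intro x hx
  change (tensorFunctor k M).map ((matrixComplex D hD).d (n + 1) n) x = 0 at hx
  rw [matrixComplex_d] at hx
  obtain ⟨m, rfl⟩ := exists_eq_ofCoord (N := ModuleCat.of R (Fin (r (n + 1)) → R)) (Pi.basisFun R _) x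
  have hx' := (map_matrixHom_ofCoord (k := k) (D n) m).symm.trans hx
  have hx'' := (coord_ofCoord (N := ModuleCat.of R (Fin (r n) → R)) (Pi.basisFun R _) _).symm.trans
    ((congrArg (coord k M (N := ModuleCat.of R (Fin (r n) → R)) (Pi.basisFun R _)) hx').trans
      (map_zero _))
  obtain ⟨m', hm'⟩ := hM m fun j => congrFun hx'' j
  refine ⟨ofCoord k (N := ModuleCat.of R (Fin (r (n + 2)) → R)) (Pi.basisFun R _) m', ?_⟩
  change (tensorFunctor k M).map ((matrixComplex D hD).d (n + 2) (n + 1)) _ = _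
  rw [matrixComplex_d]
  refine (map_matrixHom_ofCoord (k := k) (D (n + 1)) m').trans ?_
  exact congrArg (ofCoord k _) (funext fun i => (hm' i).symm)

end Resolution

end NCTor

namespace KoszulExample

open Hochschild NCTor

/-! ### The Koszul resolution -/

/-- The ranks of the terms of the Koszul resolution. -/
def koszulRank : ℕ → ℕ
  | 0 => 1
  | 1 => 3
  | 2 => 3
  | 3 => 2
  | 4 => 1
  | _ + 5 => 0

variable (k : Type u) [Field k]

/-- The first differential, with respect to the bases `x, y, z` and `1`. -/
def koszulMatrixOne : Matrix (Fin 3) (Fin 1) (EnvAlg k) :=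
  !![onL (ax k) - onR (ax k); onL (ay k) - onR (ay k); onL (az k) - onR (az k)]

/-- The second differential, with respect to the bases `ux, xz, zy` and `x, y, z`. -/
def koszulMatrixTwo : Matrix (Fin 3) (Fin 3) (EnvAlg k) :=
  !![onL (au k) + onR (ax k), onR (ax k), 0;
     onR (az k), 0, onL (ax k);
     0, onL (az k), onR (ay k)]

/-- The third differential, with respect to the bases `uxz, xzy` and `ux, xz, zy`. -/
def koszulMatrixThree : Matrix (Fin 2) (Fin 3) (EnvAlg k) :=
  !![-onR (az k), onL (au k), 0;
     0, -onR (ay k), onL (ax k)]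

/-- The fourth differential, with respect to the bases `uxzy` and `uxz, xzy`. -/
def koszulMatrixFour : Matrix (Fin 1) (Fin 2) (EnvAlg k) :=
  !![onR (ay k), onL (au k)]

/-- The differentials of the Koszul resolution. -/
def koszulD : ∀ n, Matrix (Fin (koszulRank (n + 1))) (Fin (koszulRank n)) (EnvAlg k)
  | 0 => koszulMatrixOne k
  | 1 => koszulMatrixTwo k
  | 2 => koszulMatrixThree k
  | 3 => koszulMatrixFour k
  | _ + 4 => 0

variable {k}

theorem EnvAlg.mul_neg (s t : EnvAlg k) : s * -t = -(s * t) := _root_.mul_neg s t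

theorem EnvAlg.neg_mul (s t : EnvAlg k) : -s * t = -(s * t) := _root_.neg_mul s t

theorem vecMul_koszulMatrixOne (v : Fin 3 → EnvAlg k) :
    Matrix.vecMul v (koszulMatrixOne k) = ![koszulOne (v 0) (v 1) (v 2)] := by
  ext i
  rw [Subsingleton.elim i 0]
  simp [koszulMatrixOne, Matrix.vecMul, dotProduct, Fin.sum_univ_three, koszulOne, mul_sub]
  abel

theorem vecMul_koszulMatrixTwo (v : Fin 3 → EnvAlg k) :
    Matrix.vecMul v (koszulMatrixTwo k) =
      ![v 0 * onL (au k) + v 1 * onR (az k) + v 0 * onR (ax k),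
        v 2 * onL (az k) + v 0 * onR (ax k), v 1 * onL (ax k) + v 2 * onR (ay k)] := by
  ext i
  revert i
  rw [Fin.forall_fin_succ, Fin.forall_fin_two]
  refine ⟨?_, ?_, ?_⟩ <;>
    simp [koszulMatrixTwo, Matrix.vecMul, dotProduct, Fin.sum_univ_three, mul_add] <;> abel

theorem vecMul_koszulMatrixThree (v : Fin 2 → EnvAlg k) :
    Matrix.vecMul v (koszulMatrixThree k) =
      ![-(v 0 * onR (az k)), v 0 * onL (au k) - v 1 * onR (ay k), v 1 * onL (ax k)] := by
  ext i
  revert i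
  rw [Fin.forall_fin_succ, Fin.forall_fin_two]
  refine ⟨?_, ?_, ?_⟩ <;>
    simp [koszulMatrixThree, Matrix.vecMul, dotProduct, Fin.sum_univ_two, sub_eq_add_neg,
      EnvAlg.mul_neg]

theorem vecMul_koszulMatrixFour (v : Fin 1 → EnvAlg k) :
    Matrix.vecMul v (koszulMatrixFour k) = ![v 0 * onR (ay k), v 0 * onL (au k)] := by
  ext i
  revert i
  rw [Fin.forall_fin_two]
  constructor <;> simp [koszulMatrixFour, Matrix.vecMul, dotProduct]

theorem koszulMatrixTwo_comp_one (v : Fin 3 → EnvAlg k) :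
    Matrix.vecMul (Matrix.vecMul v (koszulMatrixTwo k)) (koszulMatrixOne k) = 0 := by
  rw [vecMul_koszulMatrixOne, vecMul_koszulMatrixTwo]
  ext i
  rw [Subsingleton.elim i 0]
  exact koszulOne_two (v 0) (v 1) (v 2)

theorem koszulMatrixThree_comp_two (v : Fin 2 → EnvAlg k) :
    Matrix.vecMul (Matrix.vecMul v (koszulMatrixThree k)) (koszulMatrixTwo k) = 0 := by
  rw [vecMul_koszulMatrixTwo, vecMul_koszulMatrixThree]
  ext i
  revert i
  rw [Fin.forall_fin_succ, Fin.forall_fin_two]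
  refine ⟨?_, ?_, ?_⟩ <;>
    simp [sub_mul, EnvAlg.neg_mul, mul_assoc, onR_mul_onL, ← onR_mul, ← onL_mul]

theorem koszulMatrixFour_comp_three (v : Fin 1 → EnvAlg k) :
    Matrix.vecMul (Matrix.vecMul v (koszulMatrixFour k)) (koszulMatrixThree k) = 0 := by
  rw [vecMul_koszulMatrixThree, vecMul_koszulMatrixFour]
  ext i
  revert i
  rw [Fin.forall_fin_succ, Fin.forall_fin_two]
  refine ⟨?_, ?_, ?_⟩ <;>
    simp [mul_assoc, onR_mul_onL, ← onR_mul, ← onL_mul]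

theorem koszulD_comp (n : ℕ) (v) :
    Matrix.vecMul (Matrix.vecMul v (koszulD k (n + 1))) (koszulD k n) = 0 := by
  match n with
  | 0 => exact koszulMatrixTwo_comp_one v
  | 1 => exact koszulMatrixThree_comp_two v
  | 2 => exact koszulMatrixFour_comp_three v
  | n + 3 => simp [koszulD]

theorem koszulMatrixOne_exact (v : Fin 3 → EnvAlg k)
    (h : Matrix.vecMul v (koszulMatrixOne k) = 0) :
    ∃ w, Matrix.vecMul w (koszulMatrixTwo k) = v := by
  rw [vecMul_koszulMatrixOne] at h
  obtain ⟨a, b, c, h1, h2, h3⟩ := exact_one (congrFun h 0)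
  refine ⟨![a, b, c], (vecMul_koszulMatrixTwo _).trans ?_⟩
  ext i
  fin_cases i
  exacts [h1.symm, h2.symm, h3.symm]

theorem koszulMatrixTwo_exact (v : Fin 3 → EnvAlg k)
    (h : Matrix.vecMul v (koszulMatrixTwo k) = 0) :
    ∃ w, Matrix.vecMul w (koszulMatrixThree k) = v := by
  rw [vecMul_koszulMatrixTwo] at h
  obtain ⟨s, t, h1, h2, h3⟩ := exact_two (congrFun h 0) (congrFun h 1) (congrFun h 2)
  refine ⟨![s, t], (vecMul_koszulMatrixThree _).trans ?_⟩
  ext i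
  fin_cases i
  exacts [h1.symm, h2.symm, h3.symm]

theorem koszulMatrixThree_exact (v : Fin 2 → EnvAlg k)
    (h : Matrix.vecMul v (koszulMatrixThree k) = 0) :
    ∃ w, Matrix.vecMul w (koszulMatrixFour k) = v := by
  rw [vecMul_koszulMatrixThree] at h
  obtain ⟨e, h1, h2⟩ := exact_three (sub_eq_zero.1 (congrFun h 1)) (congrFun h 2)
  refine ⟨![e], (vecMul_koszulMatrixFour _).trans ?_⟩
  ext i
  fin_cases i
  exacts [h1.symm, h2.symm]

theorem koszulMatrixFour_injective (v : Fin 1 → EnvAlg k)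
    (h : Matrix.vecMul v (koszulMatrixFour k) = 0) : v = 0 := by
  rw [vecMul_koszulMatrixFour] at h
  ext i
  rw [Subsingleton.elim i 0]
  exact eq_zero_of_mul_onL_au (congrFun h 1)

theorem koszulD_exact (n : ℕ) (v) (h : Matrix.vecMul v (koszulD k n) = 0) :
    ∃ w, Matrix.vecMul w (koszulD k (n + 1)) = v := by
  match n with
  | 0 => exact koszulMatrixOne_exact v h
  | 1 => exact koszulMatrixTwo_exact v h
  | 2 => exact koszulMatrixThree_exact v h
  -- The next free module has rank 0, so exactness here is injectivity of the fourth differential.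
  | 3 => exact ⟨0, (Matrix.zero_vecMul _).trans (koszulMatrixFour_injective v h).symm⟩
  | n + 4 => exact ⟨0, funext fun i => i.elim0⟩

variable (k)

/-- The multiplication `Aᵉ → A`. -/
def koszulAug : (Fin 1 → EnvAlg k) →ₗ[EnvAlg k] leftA k (Alg k) :=
  LinearMap.toSpanSingleton (EnvAlg k) (leftA k (Alg k)) (toLeftA k (Alg k) 1) ∘ₗ
    LinearMap.proj 0

variable {k}

theorem koszulAug_apply (v : Fin 1 → EnvAlg k) :
    koszulAug k v = toLeftA k (Alg k) (AlgHom.mulLeftRight k (Alg k) (v 0) 1) := rfl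

theorem koszulAug_surjective : Function.Surjective (koszulAug k) := by
  intro a
  refine ⟨![onL ((toLeftA k (Alg k)).symm a)], ?_⟩
  rw [koszulAug_apply]
  simp [onL]

theorem koszulAug_koszulOne (p q r : EnvAlg k) :
    AlgHom.mulLeftRight k (Alg k) (koszulOne p q r) 1 = 0 := by
  simp [koszulOne, onL, onR]

theorem koszulAug_comp (v : Fin 3 → EnvAlg k) :
    koszulAug k (Matrix.vecMul v (koszulMatrixOne k)) = 0 := by
  rw [koszulAug_apply, vecMul_koszulMatrixOne]
  exact (congrArg _ (koszulAug_koszulOne _ _ _)).trans (map_zero _)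

theorem koszulAug_exact (v : Fin 1 → EnvAlg k) (hv : koszulAug k v = 0) :
    ∃ w, Matrix.vecMul w (koszulMatrixOne k) = v := by
  obtain ⟨p, q, r, h⟩ := exact_zero ((toLeftA k (Alg k)).injective hv)
  refine ⟨![p, q, r], (vecMul_koszulMatrixOne _).trans ?_⟩
  ext i
  rw [Subsingleton.elim i 0]
  exact h.symm

variable (k)

/-- The Koszul resolution of the algebra as a bimodule. -/
def koszulResolution : ProjectiveResolution (leftA k (Alg k)) :=
  matrixResolution (koszulD k) koszulD_comp (koszulAug k) koszulAug_comp koszulAug_surjective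
    koszulAug_exact koszulD_exact

variable {k}

/-! ### The Hochschild complex in coordinates -/

theorem op_onL_smul (a m : Alg k) :
    op (onL a) • toRightA k (Alg k) m = toRightA k (Alg k) (m * a) := by
  simpa [onL] using rightA_smul k (Alg k) a 1 m

theorem op_onR_smul (a m : Alg k) :
    op (onR a) • toRightA k (Alg k) m = toRightA k (Alg k) (a * m) := by
  simpa [onR] using rightA_smul k (Alg k) 1 a m

theorem zero_smul_rightA (m : rightA k (Alg k)) : (0 : (EnvAlg k)ᵐᵒᵖ) • m = 0 := zero_smul (EnvAlg k)ᵐᵒᵖ m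

theorem hochschild_exact_two (m : Fin 3 → rightA k (Alg k))
    (h : ∀ j, ∑ i, op (koszulMatrixTwo k i j) • m i = 0) :
    ∃ m' : Fin 2 → rightA k (Alg k), ∀ i, m i = ∑ l, op (koszulMatrixThree k l i) • m' l := by
  obtain ⟨m, rfl⟩ : ∃ m' : Fin 3 → Alg k, m = fun i => toRightA k (Alg k) (m' i) := ⟨m, rfl⟩
  have h0 := h 0
  have h1 := h 1
  have h2 := h 2
  simp [koszulMatrixTwo, Fin.sum_univ_three, op_onL_smul, op_onR_smul, add_smul, zero_smul_rightA,
    ← map_add]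
    at h0 h1 h2
  -- On the right module `A` the left factor of `Aᵉ` multiplies from the right and the right factor
  -- from the left, so the matrix equations become those of `hochschild_two`.
  obtain ⟨s, t, e0, e1, e2⟩ := hochschild_two (a := m 0) (b := m 1) (c := m 2)
    (by rw [← h0]; abel) (by rw [← h1]; abel) h2
  refine ⟨![toRightA k (Alg k) s, toRightA k (Alg k) t], ?_⟩
  rw [Fin.forall_fin_succ, Fin.forall_fin_two]
  refine ⟨?_, ?_, ?_⟩ <;>
    simp [koszulMatrixThree, Fin.sum_univ_two, op_onL_smul, op_onR_smul, zero_smul_rightA, e0,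
      e1, e2, sub_eq_add_neg]

theorem hochschild_exact_three (m : Fin 2 → rightA k (Alg k))
    (h : ∀ j, ∑ i, op (koszulMatrixThree k i j) • m i = 0) :
    ∃ m' : Fin 1 → rightA k (Alg k), ∀ i, m i = ∑ l, op (koszulMatrixFour k l i) • m' l := by
  obtain ⟨m, rfl⟩ : ∃ m' : Fin 2 → Alg k, m = fun i => toRightA k (Alg k) (m' i) := ⟨m, rfl⟩
  have h1 := h 1
  have h2 := h 2
  simp [koszulMatrixThree, Fin.sum_univ_two, op_onL_smul, op_onR_smul, zero_smul_rightA,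
    ← sub_eq_add_neg, sub_eq_zero] at h1 h2
  obtain ⟨c, e0, e1⟩ := hochschild_three h2 h1
  refine ⟨![toRightA k (Alg k) c], ?_⟩
  rw [Fin.forall_fin_two]
  constructor <;> simp [koszulMatrixFour, op_onL_smul, op_onR_smul, e0, e1]

theorem hochschild_exact_four (m : Fin 1 → rightA k (Alg k))
    (h : ∀ j, ∑ i, op (koszulMatrixFour k i j) • m i = 0) (i : Fin 1) : m i = 0 := by
  obtain ⟨m, rfl⟩ : ∃ m' : Fin 1 → Alg k, m = fun i => toRightA k (Alg k) (m' i) := ⟨m, rfl⟩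
  have h1 := h 1
  simp [koszulMatrixFour, op_onL_smul] at h1
  rw [Subsingleton.elim i 0]
  simp [hochschild_four h1]

end KoszulExample

end

theorem mainTheorem3 (k : Type u) [Field k] [CharZero k] (n : ℕ) (hn : 2 ≤ n) :
    CategoryTheory.Limits.IsZero (Hochschild.HH k (KoszulExample.Alg k) n) := by
  obtain ⟨n, rfl⟩ : ∃ j, n = j + 2 := ⟨n - 2, by omega⟩
  refine NCTor.isZero_tor_of_exact (KoszulExample.koszulD k) KoszulExample.koszulD_comp k _
    (KoszulExample.koszulResolution k) rfl (n + 1) fun m h => ?_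
  match n with
  | 0 => exact KoszulExample.hochschild_exact_two m h
  | 1 => exact KoszulExample.hochschild_exact_three m h
  -- In degree 4 the incoming term is zero, so exactness means that the cycle itself vanishes; from
  -- degree 5 on the ranks are 0.
  | 2 => exact ⟨0, fun i => (KoszulExample.hochschild_exact_four m h i).trans (by simp)⟩
  | n + 3 => exact ⟨0, fun i => i.elim0⟩
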